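/- Let $r,t$ be dimensions, $\gamma\ge 0$, $\varepsilon$ real and $k=\min\{r,t\}$. Let $|||\cdot|||$ be a unitarily invariant norm on $\mathbb{C}^{r\times t}$, i.e. $|||UAV|||=|||A|||$ for all $A$ and all unitary $U\in\mathbb{C}^{r\times r}$, $V\in\mathbb{C}^{t\times t}$. Let $\mathcal{Q}$ be a nonempty compact convex set of Hermitian positive semidefinite $t\times t$ matrices such that $UQU^H\in\mathcal{Q}$ and $D(Q)\in\mathcal{Q}$ for all $Q\in\mathcal{Q}$ and all unitary $U$, where $D(Q)$ is the diagonal matrix with the same diagonal as $Q$. Let $H_0\in\mathbb{C}^{r\times t}$ have the singular value decomposition $H_0=U_0\,\mathrm{diag}(\sigma_0)\,V_0^H$, where $U_0,V_0$ are unitary and $\sigma_0\in\mathbb{R}^k$ is the vector of singular values of $H_0$ in descending order ($\mathrm{diag}(\sigma)$ for $\sigma\in\mathbb{R}^k$ is the $r\times t$ rectangular diagonal matrix). Assume that $\mathcal{H}=\{H\in\mathbb{C}^{r\times t}:|||H-H_0|||\le\varepsilon\}$ is nonempty. There is a symmetric gauge norm $\|\cdot\|$ on $\mathbb{R}^k$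 (a norm invariant under permutations and sign changes of the coordinates) with $|||A|||=\|\sigma(A)\|$ for all $A\in\mathbb{C}^{r\times t}$, where $\sigma(A)\in\mathbb{R}^k$ is the vector of singular values in descending order; and there is a nonempty compact convex permutation-invariant set $B\subset\mathbb{R}^t$ such that $\mathcal{Q}$ is the set of Hermitian positive semidefinite $Q$ whose vector of eigenvalues $\lambda(Q)\ge 0$ (in descending order) lies in $B$. For all such $\|\cdot\|$ and $B$, consider the matrix problem $$\min_{H\in\mathcal{H}}\ \max_{Q\in\mathcal{Q}}\ \log\det\left(I_r+\gamma HQH^H\right)\qquad(1)$$ and the scalar problem $$\min_{\sigma\in\mathbb{R}^k,\ \|\sigma-\sigma_0\|\le\varepsilon,\ \sigma\ge 0}\ \ \max_{\lambda\in B,\ \lambda\ge 0}\ \sum_{i=1}^{k}\log\left(1+\gamma\sigma_i^2\lambda_i\right).\qquad(2)$$ All the inner maxima and the outer minima are attained, and (1) and (2) have the same optimal value. Problem (2) has a solution, and for every solution $(\sigma',\lambda')$ of (2), the pair $$H'=U_0\,\mathrm{diag}(\sigma')\,V_0^H,\qquad Q'=V_0\,\mathrm{diag}(\lambda')\,V_0^H$$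 is a solution of (1). (A solution of a min-max problem is a feasible pair whose inner variable attains the inner maximum for the given outer variable and whose outer variable attains the minimum of the inner maxima.) -/

import Mathlib

open scoped ComplexOrder Matrix

noncomputable section

/-- The rectangular diagonal matrix `diag(x)` of size `r × t`, for `x` of length `min r t`. -/
def rectDiag (r t : ℕ) (x : Fin (min r t) → ℝ) : Matrix (Fin r) (Fin t) ℂ :=
  Matrix.of fun i j =>
    if h : (i : ℕ) = (j : ℕ) then ((x ⟨i, lt_min i.2 (h ▸ j.2)⟩ : ℝ) : ℂ) else 0

/-- The square diagonal matrix `diag(x)` with real diagonal entries, as a complex matrix. -/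
def sqDiag {t : ℕ} (x : Fin t → ℝ) : Matrix (Fin t) (Fin t) ℂ :=
  Matrix.diagonal fun i => ((x i : ℝ) : ℂ)

/-- The `min r t` singular values of an `r × t` matrix, in descending order. -/
def singVals {r t : ℕ} (A : Matrix (Fin r) (Fin t) ℂ) : Fin (min r t) → ℝ :=
  fun i => (Matrix.toEuclideanLin A).singularValues i

/-- The eigenvalues of a Hermitian matrix, in descending order. -/
def eigVals {t : ℕ} {Q : Matrix (Fin t) (Fin t) ℂ} (hQ : Q.IsHermitian) : Fin t → ℝ :=
  fun i => hQ.eigenvalues₀ (Fin.cast (Fintype.card_fin t).symm i)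

/-- A unitarily invariant norm on the space of `r × t` complex matrices. -/
structure IsUnitarilyInvariantNorm {r t : ℕ} (N : Seminorm ℂ (Matrix (Fin r) (Fin t) ℂ)) :
    Prop where
  definite : ∀ A, N A = 0 → A = 0
  invariant : ∀ A, ∀ U ∈ Matrix.unitaryGroup (Fin r) ℂ, ∀ V ∈ Matrix.unitaryGroup (Fin t) ℂ,
    N (U * A * V) = N A

/-- A symmetric gauge function: a norm on `ℝᵏ` that is invariant under permutations and under
sign changes of the coordinates. -/
structure IsSymmetricGauge {k : ℕ} (g : Seminorm ℝ (Fin k → ℝ)) : Prop where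
  definite : ∀ x, g x = 0 → x = 0
  perm : ∀ x (p : Equiv.Perm (Fin k)), g (fun i => x (p i)) = g x
  abs : ∀ x, g (fun i => |x i|) = g x

/-- `g` is the symmetric gauge (vector) norm associated with the matrix norm `N`. -/
structure IsAssociatedGauge {r t : ℕ} (N : Seminorm ℂ (Matrix (Fin r) (Fin t) ℂ))
    (g : Seminorm ℝ (Fin (min r t) → ℝ)) : Prop where
  gauge : IsSymmetricGauge g
  eq_singVals : ∀ A, N A = g (singVals A)

/-- A unitarily invariant power constraint: a nonempty compact convex set of positive semidefinite
matrices that is closed under unitary conjugation and under taking the diagonal part. -/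
structure IsPowerConstraint {t : ℕ} (S : Set (Matrix (Fin t) (Fin t) ℂ)) : Prop where
  nonempty : S.Nonempty
  compact : IsCompact S
  convex : Convex ℝ S
  posSemidef : ∀ Q ∈ S, Q.PosSemidef
  conj_mem : ∀ Q ∈ S, ∀ U ∈ Matrix.unitaryGroup (Fin t) ℂ, U * Q * Uᴴ ∈ S
  diag_mem : ∀ Q ∈ S, Matrix.diagonal Q.diag ∈ S

/-- `B` is a region of eigenvalue vectors that describes the power constraint `S`. -/
structure IsEigenvalueRegion {t : ℕ} (S : Set (Matrix (Fin t) (Fin t) ℂ))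
    (B : Set (Fin t → ℝ)) : Prop where
  nonempty : B.Nonempty
  compact : IsCompact B
  convex : Convex ℝ B
  perm : ∀ x ∈ B, ∀ p : Equiv.Perm (Fin t), (fun i => x (p i)) ∈ B
  eq : S = {Q | ∃ hQ : Q.PosSemidef, eigVals hQ.isHermitian ∈ B ∧ 0 ≤ eigVals hQ.isHermitian}

/-- `C = min_{x ∈ X} max_{y ∈ Y} f x y`, where all the maxima and the minimum are attained. -/
structure IsMinMaxValue {α β : Type*} (f : α → β → ℝ) (X : Set α) (Y : Set β) (C : ℝ) :
    Prop where
  max_attained : ∀ x ∈ X, ∃ M, IsGreatest (f x '' Y) M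
  isLeast : IsLeast {M | ∃ x ∈ X, IsGreatest (f x '' Y) M} C

/-- `(x, y)` solves `min_{x ∈ X} max_{y ∈ Y} f x y`: `y` attains the maximum for this `x`, and `x`
attains the minimum of the maxima. -/
structure IsMinMaxSolution {α β : Type*} (f : α → β → ℝ) (X : Set α) (Y : Set β)
    (x : α) (y : β) : Prop where
  mem_left : x ∈ X
  mem_right : y ∈ Y
  isGreatest : IsGreatest (f x '' Y) (f x y)
  isMinMaxValue : IsMinMaxValue f X Y (f x y)

/-- The mutual information `log det (I + γ H Q Hᴴ)`; the determinant is a real number when `Q` is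
Hermitian. -/
def mutualInfo {r t : ℕ} (γ : ℝ) (H : Matrix (Fin r) (Fin t) ℂ) (Q : Matrix (Fin t) (Fin t) ℂ) :
    ℝ :=
  Real.log ((1 + (γ : ℂ) • (H * Q * Hᴴ)).det).re

/-- The scalar objective `∑_{i ≤ min r t} log (1 + γ σᵢ² lᵢ)`. -/
def scalarInfo {r t : ℕ} (γ : ℝ) (σ : Fin (min r t) → ℝ) (l : Fin t → ℝ) : ℝ :=
  ∑ i : Fin (min r t), Real.log (1 + γ * σ i ^ 2 * l (Fin.castLE (min_le_right r t) i))

/-- The channel uncertainty region `{H : N (H - H₀) ≤ ε}`. -/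
def channelBall {r t : ℕ} (N : Seminorm ℂ (Matrix (Fin r) (Fin t) ℂ))
    (H₀ : Matrix (Fin r) (Fin t) ℂ) (ε : ℝ) : Set (Matrix (Fin r) (Fin t) ℂ) :=
  {H | N (H - H₀) ≤ ε}

/-- The feasible set `{σ : g (σ - σ₀) ≤ ε, σ ≥ 0}`. -/
def scalarBall {k : ℕ} (g : Seminorm ℝ (Fin k → ℝ)) (σ₀ : Fin k → ℝ) (ε : ℝ) :
    Set (Fin k → ℝ) :=
  {σ | g (σ - σ₀) ≤ ε ∧ 0 ≤ σ}

/-- The feasible set `{l ∈ B : l ≥ 0}`. -/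
def powerRegion {t : ℕ} (B : Set (Fin t → ℝ)) : Set (Fin t → ℝ) :=
  {l | l ∈ B ∧ 0 ≤ l}

end

/-!
The inner maximum depends on the channel only through its singular values. If `H = U diag(σ) Vᴴ`,
the unitary factors disappear from the determinant because the constraint set is unitarily
invariant. By Hadamard's inequality, replacing `Q` by its diagonal in the frame `V` can only
increase the mutual information; the constraint set is closed under this operation, so the inner
maximum is that of the scalar objective at `σ` (`isGreatest_mutualInfo_iff`).

For the outer minimum, a feasible scalar `σ` gives the feasible channel `U₀ diag(σ) V₀ᴴ`.
Conversely, the singular values of a feasible channel are feasible for the scalar problem: this is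
Mirsky's inequality `‖σ(H) - σ(H₀)‖ ≤ |||H - H₀|||` (`IsUnitarilyInvariantNorm.singVals_sub_le`).
So the two problems have the same value, and solutions of the scalar problem, which exist by
compactness, transfer to the matrix problem.

Mirsky's inequality is proved by following the segment from `H₀` to `H`. Write
`A + sE = U_s Σ_s V_sᴴ`. Then `Σ_s = U_sᴴ A V_s + s U_sᴴ E V_s`. The real diagonal of the second term
has norm at most `s |||E|||` by pinching (`IsUnitarilyInvariantNorm.pinching_le`), and that of the
first is `σ(A)` up to `O(s²)` (`diag_sub_singVals_isBigO`): between different singular values, the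
transition matrices from the frames of `A` to those of `A + sE` have entries of order `s`, because
the singular values are continuous, and the diagonal involves only the squares of these entries.
Hence the singular values move with speed at most `|||E|||`, and a mean value inequality for
one-sided slopes gives the claim.

The gauge and the nonnegative part of the eigenvalue region are forced: the gauge at `x` is the
norm of `diag(x)` (`IsAssociatedGauge.apply_eq`), and the region consists of the vectors `l` with
`diag(l)` in the constraint set (`IsEigenvalueRegion.powerRegion_eq`).
-/

/-! ### Rectangular diagonal matrices -/

section
variable {r t : ℕ}

lemma rectDiag_apply_castLE (x : Fin (min r t) → ℝ) (a : Fin (min r t)) :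
    rectDiag r t x (Fin.castLE (min_le_left r t) a) (Fin.castLE (min_le_right r t) a) = x a := by
  simp [rectDiag]

lemma rectDiag_mul_apply_castLE {m : Type*} (x : Fin (min r t) → ℝ) (M : Matrix (Fin t) m ℂ)
    (a : Fin (min r t)) (j : m) :
    (rectDiag r t x * M) (Fin.castLE (min_le_left r t) a) j
      = x a * M (Fin.castLE (min_le_right r t) a) j := by
  rw [Matrix.mul_apply, Finset.sum_eq_single (Fin.castLE (min_le_right r t) a)]
  · rw [rectDiag_apply_castLE]
  · intro b _ hb
    have : ¬ ((a : ℕ) = b) := fun h => hb (Fin.ext h.symm)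
    simp [rectDiag, this]
  · simp

lemma mul_rectDiag_apply_castLE {m : Type*} (x : Fin (min r t) → ℝ) (M : Matrix m (Fin r) ℂ)
    (i : m) (a : Fin (min r t)) :
    (M * rectDiag r t x) i (Fin.castLE (min_le_right r t) a)
      = M i (Fin.castLE (min_le_left r t) a) * x a := by
  rw [Matrix.mul_apply, Finset.sum_eq_single (Fin.castLE (min_le_left r t) a)]
  · rw [rectDiag_apply_castLE]
  · intro b _ hb
    have : ¬ ((b : ℕ) = a) := fun h => hb (Fin.ext h)
    simp [rectDiag, this]
  · simp

lemma rectDiag_mul_apply_of_notMem {m : Type*} (x : Fin (min r t) → ℝ)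
    (M : Matrix (Fin t) m ℂ) {i : Fin r} (hi : i ∉ Set.range (Fin.castLE (min_le_left r t)))
    (j : m) : (rectDiag r t x * M) i j = 0 := by
  rw [Matrix.mul_apply]
  refine Finset.sum_eq_zero fun b _ => ?_
  have : ¬ ((i : ℕ) = b) := fun h => hi ⟨⟨i, lt_min i.2 (h ▸ b.2)⟩, Fin.ext rfl⟩
  simp [rectDiag, this]

lemma mul_rectDiag_apply_of_notMem {m : Type*} (x : Fin (min r t) → ℝ)
    (M : Matrix m (Fin r) ℂ) (i : m) {j : Fin t}
    (hj : j ∉ Set.range (Fin.castLE (min_le_right r t))) :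
    (M * rectDiag r t x) i j = 0 := by
  rw [Matrix.mul_apply]
  refine Finset.sum_eq_zero fun b _ => ?_
  have : ¬ ((b : ℕ) = j) := fun h => hj ⟨⟨j, lt_min (h ▸ b.2) j.2⟩, Fin.ext rfl⟩
  simp [rectDiag, this]

lemma rectDiag_add (x y : Fin (min r t) → ℝ) :
    rectDiag r t (x + y) = rectDiag r t x + rectDiag r t y := by
  ext i j; simp only [rectDiag, Matrix.of_apply, Matrix.add_apply]; split_ifs <;> simp

lemma rectDiag_smul (c : ℝ) (x : Fin (min r t) → ℝ) :
    rectDiag r t (c • x) = (c : ℂ) • rectDiag r t x := by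
  ext i j; simp only [rectDiag, Matrix.of_apply, Matrix.smul_apply]; split_ifs <;> simp

lemma continuous_rectDiag : Continuous (rectDiag r t) := by
  refine continuous_matrix fun i j => ?_
  simp only [rectDiag, Matrix.of_apply]
  split_ifs <;> fun_prop

lemma diagonal_mem_unitaryGroup {n : ℕ} {p : Fin n → ℂ} (hp : ∀ i, ‖p i‖ = 1) :
    Matrix.diagonal p ∈ Matrix.unitaryGroup (Fin n) ℂ := by
  rw [Matrix.mem_unitaryGroup_iff, Matrix.star_eq_conjTranspose, Matrix.diagonal_conjTranspose,
    Matrix.diagonal_mul_diagonal, ← Matrix.diagonal_one]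
  congr 1
  funext i
  have := Complex.mul_conj' (p i)
  simpa [hp i] using this

lemma permMatrix_mem_unitaryGroup {n : ℕ} (e : Equiv.Perm (Fin n)) :
    (1 : Matrix (Fin n) (Fin n) ℂ).submatrix e id ∈ Matrix.unitaryGroup (Fin n) ℂ := by
  rw [Matrix.mem_unitaryGroup_iff, Matrix.star_eq_conjTranspose, Matrix.conjTranspose_submatrix,
    Matrix.conjTranspose_one, ← Matrix.submatrix_mul _ _ _ _ _ Function.bijective_id]
  simp

lemma conjTranspose_mul_mul_of_eq {r t : ℕ} {A D : Matrix (Fin r) (Fin t) ℂ}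
    {U : Matrix (Fin r) (Fin r) ℂ} (hU : U ∈ Matrix.unitaryGroup (Fin r) ℂ)
    {V : Matrix (Fin t) (Fin t) ℂ} (hV : V ∈ Matrix.unitaryGroup (Fin t) ℂ)
    (h : A = U * D * Vᴴ) : Uᴴ * A * V = D := by
  have e1 : Uᴴ * U = 1 := Matrix.mem_unitaryGroup_iff'.1 hU
  have e2 : Vᴴ * V = 1 := Matrix.mem_unitaryGroup_iff'.1 hV
  rw [h, Matrix.mul_assoc U, ← Matrix.mul_assoc Uᴴ, e1, Matrix.one_mul, Matrix.mul_assoc, e2,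
    Matrix.mul_one]

/-- Permuting the entries of a rectangular diagonal matrix is multiplication by permutation
matrices on both sides. -/
lemma exists_unitary_rectDiag_perm (x : Fin (min r t) → ℝ) (p : Equiv.Perm (Fin (min r t))) :
    ∃ U ∈ Matrix.unitaryGroup (Fin r) ℂ, ∃ V ∈ Matrix.unitaryGroup (Fin t) ℂ,
      rectDiag r t (fun i => x (p i)) = U * rectDiag r t x * Vᴴ := by
  let er := p.viaFintypeEmbedding (Fin.castLEEmb (min_le_left r t))
  let et := p.viaFintypeEmbedding (Fin.castLEEmb (min_le_right r t))
  refine ⟨_, permMatrix_mem_unitaryGroup er, _, permMatrix_mem_unitaryGroup et, ?_⟩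
  have hr : ∀ a, er (Fin.castLE (min_le_left r t) a) = Fin.castLE (min_le_left r t) (p a) :=
    fun a => p.viaFintypeEmbedding_apply_image (Fin.castLEEmb (min_le_left r t)) a
  have ht : ∀ a, et (Fin.castLE (min_le_right r t) a) = Fin.castLE (min_le_right r t) (p a) :=
    fun a => p.viaFintypeEmbedding_apply_image (Fin.castLEEmb (min_le_right r t)) a
  have key : (1 : Matrix (Fin r) (Fin r) ℂ).submatrix er id * rectDiag r t x *
      ((1 : Matrix (Fin t) (Fin t) ℂ).submatrix et id)ᴴ = (rectDiag r t x).submatrix er et := by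
    ext i j
    simp [Matrix.mul_apply, Matrix.one_apply]
  rw [key]
  ext i j
  rw [Matrix.submatrix_apply]
  by_cases h : (i : ℕ) = j
  · obtain ⟨a, rfl⟩ : ∃ a, i = Fin.castLE (min_le_left r t) a :=
      ⟨⟨i, lt_min i.2 (h ▸ j.2)⟩, rfl⟩
    obtain rfl : j = Fin.castLE (min_le_right r t) a := Fin.ext h.symm
    rw [hr, ht, rectDiag_apply_castLE, rectDiag_apply_castLE]
  · rw [rectDiag, Matrix.of_apply, dif_neg h, rectDiag, Matrix.of_apply, dif_neg]
    intro h'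
    obtain ⟨a, ha⟩ : ∃ a, er i = Fin.castLE (min_le_left r t) a :=
      ⟨⟨er i, lt_min (er i).2 (h' ▸ (et j).2)⟩, rfl⟩
    have ha' : et j = Fin.castLE (min_le_right r t) a := by
      apply Fin.ext; rw [← h', ha]; rfl
    obtain ⟨b, rfl⟩ := p.surjective a
    rw [← hr] at ha
    rw [← ht] at ha'
    rw [er.injective ha, et.injective ha'] at h
    exact h rfl

/-- Sign changes of the entries of a rectangular diagonal matrix are realised by a diagonal
unitary factor. -/
lemma exists_unitary_rectDiag_abs (x : Fin (min r t) → ℝ) :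
    ∃ U ∈ Matrix.unitaryGroup (Fin r) ℂ,
      rectDiag r t (fun i => |x i|) = U * rectDiag r t x := by
  refine ⟨Matrix.diagonal fun i => if h : (i : ℕ) < min r t then
    (if x ⟨i, h⟩ < 0 then -1 else 1) else 1, diagonal_mem_unitaryGroup fun i => ?_, ?_⟩
  · split_ifs <;> simp
  · ext i j
    rw [Matrix.diagonal_mul]
    by_cases h : (i : ℕ) = j
    · have hi : (i : ℕ) < min r t := lt_min i.2 (h ▸ j.2)
      simp only [rectDiag, Matrix.of_apply, dif_pos h, dif_pos hi]
      split_ifs with hx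
      · simp [abs_of_neg hx]
      · simp [abs_of_nonneg (not_lt.1 hx)]
    · simp [rectDiag, h]

end

/-! ### Pinching -/

namespace IsUnitarilyInvariantNorm
variable {r t : ℕ} {N : Seminorm ℂ (Matrix (Fin r) (Fin t) ℂ)}

lemma conj_eq (hN : IsUnitarilyInvariantNorm N) (A : Matrix (Fin r) (Fin t) ℂ)
    {U : Matrix (Fin r) (Fin r) ℂ} (hU : U ∈ Matrix.unitaryGroup (Fin r) ℂ)
    {V : Matrix (Fin t) (Fin t) ℂ} (hV : V ∈ Matrix.unitaryGroup (Fin t) ℂ) :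
    N (U * A * Vᴴ) = N A :=
  hN.invariant A U hU _ (Unitary.star_mem hV)

lemma average_le (N : Seminorm ℂ (Matrix (Fin r) (Fin t) ℂ)) {A B : Matrix (Fin r) (Fin t) ℂ}
    (h : N B = N A) : N ((1 / 2 : ℂ) • (A + B)) ≤ N A := by
  rw [map_smul_eq_mul]
  have := map_add_le_add N A B
  rw [h] at this
  norm_num
  linarith

/-- Averaging a matrix with its conjugate by a reflection of the `n`-th coordinate kills the
off-diagonal entries of row and column `n`; iterating leaves only the diagonal. -/
lemma clear_le (hN : IsUnitarilyInvariantNorm N) (M : Matrix (Fin r) (Fin t) ℂ) (n : ℕ) :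
    N (Matrix.of fun i j => if (i : ℕ) ≠ j ∧ ((i : ℕ) < n ∨ (j : ℕ) < n) then 0 else M i j)
      ≤ N M := by
  induction n with
  | zero => simp; rfl
  | succ n ih =>
    refine le_trans ?_ ih
    set P : Matrix (Fin r) (Fin t) ℂ :=
      Matrix.of fun i j => if (i : ℕ) ≠ j ∧ ((i : ℕ) < n ∨ (j : ℕ) < n) then 0 else M i j
    have h := hN.invariant P
      (Matrix.diagonal fun i => if (i : ℕ) = n then -1 else 1)
      (diagonal_mem_unitaryGroup fun i => by split_ifs <;> simp)
      (Matrix.diagonal fun i => if (i : ℕ) = n then -1 else 1)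
      (diagonal_mem_unitaryGroup fun i => by split_ifs <;> simp)
    refine le_trans (le_of_eq (congrArg N ?_)) (average_le N h)
    ext i j
    simp only [P, Matrix.of_apply, Matrix.smul_apply, Matrix.add_apply, Matrix.mul_diagonal,
      Matrix.diagonal_mul, smul_eq_mul]
    split_ifs <;> first | omega | ring

/-- Pinching: replacing a matrix by the real part of its diagonal does not increase a unitarily
invariant norm. -/
lemma pinching_le (hN : IsUnitarilyInvariantNorm N) (M : Matrix (Fin r) (Fin t) ℂ) :
    N (rectDiag r t fun i =>
      (M (Fin.castLE (min_le_left r t) i) (Fin.castLE (min_le_right r t) i)).re) ≤ N M := by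
  refine le_trans ?_ (hN.clear_le M r)
  set D : Matrix (Fin r) (Fin t) ℂ :=
    Matrix.of fun i j => if (i : ℕ) ≠ j ∧ ((i : ℕ) < r ∨ (j : ℕ) < r) then 0 else M i j
  -- the phases that conjugate the diagonal entries
  let p : Fin r → ℂ := fun i => if h : (i : ℕ) < t then
    (if M i ⟨i, h⟩ = 0 then 1 else star (M i ⟨i, h⟩) / M i ⟨i, h⟩) else 1
  have hp : ∀ i, ‖p i‖ = 1 := by
    intro i
    simp only [p]
    split_ifs with h h0
    · simp
    · rw [norm_div, norm_star, div_self (norm_ne_zero_iff.2 h0)]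
    · simp
  have h := hN.invariant D _ (diagonal_mem_unitaryGroup hp) 1 (one_mem _)
  refine le_trans (le_of_eq (congrArg N ?_)) (average_le N h)
  ext i j
  rw [Matrix.mul_one, Matrix.smul_apply, Matrix.add_apply, Matrix.diagonal_mul]
  by_cases hij : (i : ℕ) = j
  · have hit : (i : ℕ) < t := hij ▸ j.2
    obtain rfl : j = ⟨i, hit⟩ := Fin.ext hij.symm
    have e1 : D i ⟨i, hit⟩ = M i ⟨i, hit⟩ := by simp [D]
    have e2 : rectDiag r t (fun i => (M (Fin.castLE (min_le_left r t) i)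
        (Fin.castLE (min_le_right r t) i)).re) i ⟨i, hit⟩ = ((M i ⟨i, hit⟩).re : ℂ) := by
      simp [rectDiag]
    rw [e1, e2, Complex.re_eq_add_conj]
    simp only [p, dif_pos hit]
    split_ifs with h0
    · simp [h0]
    · rw [div_mul_cancel₀ _ h0, smul_eq_mul, Complex.star_def]; ring
  · have : D i j = 0 := by simp [D, hij]
    simp [this, rectDiag, hij]

end IsUnitarilyInvariantNorm

/-! ### Eigenvalues -/

section
variable {t : ℕ}

lemma sqDiag_isHermitian (y : Fin t → ℝ) : (sqDiag y).IsHermitian := by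
  rw [Matrix.IsHermitian, sqDiag, Matrix.diagonal_conjTranspose]
  congr 1; funext i; simp

lemma eigVals_antitone {Q : Matrix (Fin t) (Fin t) ℂ} (hQ : Q.IsHermitian) :
    Antitone (eigVals hQ) := fun _ _ h => hQ.eigenvalues₀_antitone (by simpa using h)

lemma roots_charpoly_conj_sqDiag {V : Matrix (Fin t) (Fin t) ℂ}
    (hV : V ∈ Matrix.unitaryGroup (Fin t) ℂ) (y : Fin t → ℝ) :
    (V * sqDiag y * Vᴴ).charpoly.roots.map (RCLike.re : ℂ → ℝ) = (List.ofFn y : Multiset ℝ) := by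
  have h : Vᴴ * V = 1 := Matrix.mem_unitaryGroup_iff'.1 hV
  rw [Matrix.charpoly_mul_comm, ← Matrix.mul_assoc, h, Matrix.one_mul, sqDiag,
    Matrix.charpoly_diagonal, Polynomial.roots_prod _ _ (by
      simp [Finset.prod_ne_zero_iff, Polynomial.X_sub_C_ne_zero])]
  simp [Function.comp_def]

/-- The ordered eigenvalues of a unitarily diagonalised matrix are a rearrangement of its diagonal
entries. -/
lemma exists_perm_eigVals {Q V : Matrix (Fin t) (Fin t) ℂ} (hQ : Q.IsHermitian)
    (hV : V ∈ Matrix.unitaryGroup (Fin t) ℂ) {y : Fin t → ℝ} (h : Q = V * sqDiag y * Vᴴ) :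
    ∃ p : Equiv.Perm (Fin t), eigVals hQ = fun i => y (p i) := by
  let p := Tuple.sort (fun i => OrderDual.toDual (y i))
  have hp : Antitone (y ∘ p) := Tuple.monotone_sort (fun i => OrderDual.toDual (y i))
  refine ⟨p, List.ofFn_injective ?_⟩
  have h1 := hQ.sort_roots_charpoly_eq_eigenvalues₀
  have h2 : (List.ofFn (eigVals hQ)) = List.ofFn hQ.eigenvalues₀ :=
    (List.ofFn_congr (Fintype.card_fin t) _).symm
  have h3 : (List.ofFn (eigVals hQ)).Perm (List.ofFn y) := by
    rw [← Multiset.coe_eq_coe, ← roots_charpoly_conj_sqDiag hV y, ← h, h2, ← h1, Multiset.sort_eq]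
  exact (h3.trans (p.ofFn_comp_perm y).symm).eq_of_pairwise'
    (eigVals_antitone hQ).sortedGE_ofFn.pairwise hp.sortedGE_ofFn.pairwise

lemma eigVals_eq_of_antitone {Q V : Matrix (Fin t) (Fin t) ℂ} (hQ : Q.IsHermitian)
    (hV : V ∈ Matrix.unitaryGroup (Fin t) ℂ) {y : Fin t → ℝ} (hy : Antitone y)
    (h : Q = V * sqDiag y * Vᴴ) : eigVals hQ = y := by
  obtain ⟨p, hp⟩ := exists_perm_eigVals hQ hV h
  have h1 := eigVals_antitone hQ
  rw [hp] at h1 ⊢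
  exact Tuple.unique_antitone (σ := p) (τ := 1) h1 hy

/-- The spectral theorem in terms of the ordered eigenvalues. -/
lemma exists_unitary_eq_eigVals {Q : Matrix (Fin t) (Fin t) ℂ} (hQ : Q.IsHermitian) :
    ∃ V ∈ Matrix.unitaryGroup (Fin t) ℂ, ∃ p : Equiv.Perm (Fin t),
      Q = V * sqDiag (fun i => eigVals hQ (p i)) * Vᴴ := by
  let p : Equiv.Perm (Fin t) := (Fintype.equivOfCardEq (Fintype.card_fin _)).symm.trans
    (finCongr (Fintype.card_fin t))
  refine ⟨_, hQ.eigenvectorUnitary.2, p, ?_⟩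
  conv_lhs => rw [hQ.spectral_theorem]
  rfl

end

/-! ### Singular value decomposition -/

section
variable {r t : ℕ}

lemma singVals_nonneg (A : Matrix (Fin r) (Fin t) ℂ) : 0 ≤ singVals A :=
  fun i => LinearMap.singularValues_nonneg _ i

lemma singVals_antitone (A : Matrix (Fin r) (Fin t) ℂ) : Antitone (singVals A) :=
  fun _ _ h => LinearMap.singularValues_antitone _ h

lemma eigenvalues_congr {n m : ℕ} {E : Type*} [NormedAddCommGroup E] [InnerProductSpace ℂ E]
    [FiniteDimensional ℂ E] {T T' : E →ₗ[ℂ] E} (hT : T.IsSymmetric) (hT' : T'.IsSymmetric)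
    (hn : Module.finrank ℂ E = n) (hm : Module.finrank ℂ E = m) (h : T = T') (i : Fin n) :
    hT.eigenvalues hn i = hT'.eigenvalues hm (Fin.cast (hn.symm.trans hm) i) := by
  subst h hn hm; rfl

lemma sq_singVals (A : Matrix (Fin r) (Fin t) ℂ) (i : Fin (min r t)) :
    singVals A i ^ 2 = eigVals (Matrix.isHermitian_conjTranspose_mul_self A)
      (Fin.castLE (min_le_right r t) i) := by
  have h : LinearMap.adjoint (Matrix.toEuclideanLin A) ∘ₗ Matrix.toEuclideanLin A
      = Matrix.toEuclideanLin (Aᴴ * A) := by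
    rw [← Matrix.toEuclideanLin_conjTranspose_eq_adjoint, Matrix.toLpLin_mul (q := 2)]
  have hn : Module.finrank ℂ (EuclideanSpace ℂ (Fin t)) = t := by simp
  have h1 := (Matrix.toEuclideanLin A).sq_singularValues_fin hn
    (Fin.castLE (min_le_right r t) i)
  rw [eigenvalues_congr _
    (Matrix.isSymmetric_toEuclideanLin_iff.mpr (Matrix.isHermitian_conjTranspose_mul_self A))
    hn finrank_euclideanSpace h] at h1
  exact h1

/-- Uniqueness of singular values. -/
lemma singVals_eq_of_antitone {A : Matrix (Fin r) (Fin t) ℂ} {U : Matrix (Fin r) (Fin r) ℂ}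
    (hU : U ∈ Matrix.unitaryGroup (Fin r) ℂ) {V : Matrix (Fin t) (Fin t) ℂ}
    (hV : V ∈ Matrix.unitaryGroup (Fin t) ℂ) {x : Fin (min r t) → ℝ} (hx : Antitone x)
    (hx0 : 0 ≤ x) (h : A = U * rectDiag r t x * Vᴴ) : singVals A = x := by
  let y : Fin t → ℝ := fun j => if h : (j : ℕ) < min r t then x ⟨j, h⟩ ^ 2 else 0
  have hy_in : ∀ a : Fin (min r t), y (Fin.castLE (min_le_right r t) a) = x a ^ 2 :=
    fun a => dif_pos a.2
  have hy_out : ∀ j, j ∉ Set.range (Fin.castLE (min_le_right r t)) → y j = 0 :=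
    fun j hj => dif_neg fun h => hj ⟨⟨j, h⟩, rfl⟩
  have hy : Antitone y := by
    intro i j hij
    simp only [y]
    have hij' : (i : ℕ) ≤ j := hij
    split_ifs with h1 h2 h2
    · exact pow_le_pow_left₀ (hx0 _) (hx (by simpa using hij')) 2
    · omega
    · positivity
    · rfl
  have hD : (rectDiag r t x)ᴴ * rectDiag r t x = sqDiag y := by
    ext i j
    by_cases hj : j ∈ Set.range (Fin.castLE (min_le_right r t))
    · obtain ⟨a, rfl⟩ := hj
      rw [mul_rectDiag_apply_castLE, Matrix.conjTranspose_apply]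
      by_cases hi : i = Fin.castLE (min_le_right r t) a
      · subst hi
        rw [rectDiag_apply_castLE]
        simp [sqDiag, hy_in, sq]
      · have h1 : ¬ ((a : ℕ) = i) := fun h => hi (Fin.ext h.symm)
        simp [rectDiag, sqDiag, h1, Matrix.diagonal_apply_ne _ hi]
    · rw [mul_rectDiag_apply_of_notMem _ _ _ hj]
      by_cases hi : i = j
      · subst hi; simp [sqDiag, hy_out _ hj]
      · rw [sqDiag, Matrix.diagonal_apply_ne _ hi]
  have hUU : Uᴴ * U = 1 := Matrix.mem_unitaryGroup_iff'.1 hU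
  have hA : Aᴴ * A = V * sqDiag y * Vᴴ := by
    rw [h, ← hD]
    simp only [Matrix.conjTranspose_mul, Matrix.conjTranspose_conjTranspose, Matrix.mul_assoc]
    rw [← Matrix.mul_assoc Uᴴ, hUU, Matrix.one_mul]
  funext i
  have h1 := sq_singVals A i
  rw [eigVals_eq_of_antitone _ hV hy hA] at h1
  rw [hy_in] at h1
  exact (pow_left_inj₀ (singVals_nonneg A i) (hx0 i) two_ne_zero).1 h1

/-- Existence of the singular value decomposition. -/
lemma exists_svd (A : Matrix (Fin r) (Fin t) ℂ) :
    ∃ U ∈ Matrix.unitaryGroup (Fin r) ℂ, ∃ V ∈ Matrix.unitaryGroup (Fin t) ℂ,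
      A = U * rectDiag r t (singVals A) * Vᴴ := by
  set T := Matrix.toEuclideanLin A with hT
  have hn : Module.finrank ℂ (EuclideanSpace ℂ (Fin t)) = t := by simp
  let v := T.isSymmetric_adjoint_comp_self.eigenvectorBasis hn
  have hv : ∀ i j, inner ℂ (T (v i)) (T (v j))
      = if i = j then ((T.singularValues j : ℂ)) ^ 2 else 0 := by
    intro i j
    rw [← LinearMap.adjoint_inner_right, ← LinearMap.comp_apply,
      T.isSymmetric_adjoint_comp_self.apply_eigenvectorBasis hn, inner_smul_right,
      ← T.sq_singularValues_fin hn, v.inner_eq_ite]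
    split_ifs <;> simp
  let s : Set (Fin r) := {i | ∃ _ : (i : ℕ) < t, 0 < T.singularValues i}
  let w : Fin r → EuclideanSpace ℂ (Fin r) := fun i =>
    if h : (i : ℕ) < t then ((T.singularValues i : ℂ))⁻¹ • T (v ⟨i, h⟩) else 0
  have hw : Orthonormal ℂ (s.domRestrict w) := by
    rw [orthonormal_iff_ite]
    rintro ⟨i, hi, hi0⟩ ⟨j, hj, hj0⟩
    have hj0' : (T.singularValues j : ℂ) ≠ 0 := by exact_mod_cast hj0.ne'
    simp only [Set.domRestrict_apply, w, dif_pos hi, dif_pos hj, inner_smul_left,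
      inner_smul_right, hv, Subtype.mk.injEq, Fin.ext_iff]
    split_ifs with hij
    · simp only [hij, map_inv₀, Complex.conj_ofReal]
      field_simp
    · simp
  obtain ⟨b, hb⟩ := hw.exists_orthonormalBasis_extension_of_card_eq (by simp)
  have hTv : ∀ j : Fin t, T (v j)
      = if h : (j : ℕ) < r then (T.singularValues j : ℂ) • b ⟨j, h⟩ else 0 := by
    intro j
    rcases (T.singularValues_nonneg j).eq_or_lt with h0 | h0
    · have h1 : T (v j) = 0 := by
        rw [← inner_self_eq_zero (𝕜 := ℂ), hv, if_pos rfl, ← h0]; simp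
      rw [h1, ← h0]; split_ifs <;> simp
    · have h1 : (j : ℕ) < r := by
        have h2 := T.singularValues_pos_iff_lt_finrank_range.1 h0
        refine h2.trans_le ((Submodule.finrank_le _).trans ?_)
        simp
      have h0' : (T.singularValues j : ℂ) ≠ 0 := by exact_mod_cast h0.ne'
      rw [dif_pos h1, hb ⟨j, h1⟩ ⟨j.2, h0⟩]
      simp only [w, dif_pos j.2, smul_smul, mul_inv_cancel₀ h0', one_smul]
  let U := (EuclideanSpace.basisFun (Fin r) ℂ).toBasis.toMatrix b
  let V := (EuclideanSpace.basisFun (Fin t) ℂ).toBasis.toMatrix v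
  have hU : U ∈ Matrix.unitaryGroup (Fin r) ℂ :=
    (EuclideanSpace.basisFun (Fin r) ℂ).toMatrix_orthonormalBasis_mem_unitary b
  have hV : V ∈ Matrix.unitaryGroup (Fin t) ℂ :=
    (EuclideanSpace.basisFun (Fin t) ℂ).toMatrix_orthonormalBasis_mem_unitary v
  have hAV : A * V = U * rectDiag r t (singVals A) := by
    ext i j
    have h1 : (A * V) i j = T (v j) i := rfl
    rw [h1, hTv]
    by_cases hj : (j : ℕ) < r
    · obtain ⟨a, rfl⟩ : ∃ a, j = Fin.castLE (min_le_right r t) a := ⟨⟨j, lt_min hj j.2⟩, rfl⟩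
      rw [mul_rectDiag_apply_castLE, dif_pos hj]
      exact mul_comm _ _
    · have hj' : j ∉ Set.range (Fin.castLE (min_le_right r t)) := by
        rintro ⟨a, rfl⟩; exact hj (a.2.trans_le (min_le_left _ _))
      rw [mul_rectDiag_apply_of_notMem _ _ _ hj', dif_neg hj]
      rfl
  have hVV : V * Vᴴ = 1 := Matrix.mem_unitaryGroup_iff.1 hV
  exact ⟨U, hU, V, hV, by rw [← hAV, Matrix.mul_assoc, hVV, Matrix.mul_one]⟩

/-- The singular values of a real rectangular diagonal matrix are the rearranged absolute values
of its diagonal entries. -/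
lemma exists_perm_singVals_rectDiag (x : Fin (min r t) → ℝ) :
    ∃ p : Equiv.Perm (Fin (min r t)), singVals (rectDiag r t x) = fun i => |x (p i)| := by
  let p := Tuple.sort (fun i => OrderDual.toDual |x i|)
  have hp : Antitone ((fun i => |x i|) ∘ p) :=
    Tuple.monotone_sort (fun i => OrderDual.toDual |x i|)
  obtain ⟨U, hU, h1⟩ := exists_unitary_rectDiag_abs x
  obtain ⟨U', hU', V', hV', h2⟩ := exists_unitary_rectDiag_perm (fun i => |x i|) p
  refine ⟨p, singVals_eq_of_antitone (U := Uᴴ * U'ᴴ) (V := V'ᴴ)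
    (mul_mem (Unitary.star_mem hU) (Unitary.star_mem hU')) (Unitary.star_mem hV') hp
    (fun i => abs_nonneg _) ?_⟩
  have e1 : Uᴴ * U = 1 := Matrix.mem_unitaryGroup_iff'.1 hU
  have e2 : U'ᴴ * U' = 1 := Matrix.mem_unitaryGroup_iff'.1 hU'
  have e3 : V'ᴴ * V' = 1 := Matrix.mem_unitaryGroup_iff'.1 hV'
  change _ = _ * rectDiag r t (fun i => |x (p i)|) * _
  rw [h2, h1, Matrix.conjTranspose_conjTranspose]
  simp only [Matrix.mul_assoc]
  rw [e3, Matrix.mul_one, ← Matrix.mul_assoc U'ᴴ, e2, Matrix.one_mul, ← Matrix.mul_assoc, e1,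
    Matrix.one_mul]

end

/-! ### The gauge of a unitarily invariant norm -/

section
variable {r t : ℕ}

/-- The restriction of a norm on matrices to the real rectangular diagonal ones. -/
noncomputable def diagSeminorm (N : Seminorm ℂ (Matrix (Fin r) (Fin t) ℂ)) :
    Seminorm ℝ (Fin (min r t) → ℝ) :=
  Seminorm.of (fun x => N (rectDiag r t x))
    (fun x y => by rw [rectDiag_add]; exact map_add_le_add N _ _)
    (fun c x => by rw [rectDiag_smul, map_smul_eq_mul]; simp)

variable {N : Seminorm ℂ (Matrix (Fin r) (Fin t) ℂ)}

lemma diagSeminorm_apply (x : Fin (min r t) → ℝ) : diagSeminorm N x = N (rectDiag r t x) := rfl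

lemma IsUnitarilyInvariantNorm.eq_diagSeminorm_singVals (hN : IsUnitarilyInvariantNorm N)
    (A : Matrix (Fin r) (Fin t) ℂ) : N A = diagSeminorm N (singVals A) := by
  obtain ⟨U, hU, V, hV, h⟩ := exists_svd A
  conv_lhs => rw [h]
  exact hN.conj_eq _ hU hV

lemma IsUnitarilyInvariantNorm.isAssociatedGauge (hN : IsUnitarilyInvariantNorm N) :
    IsAssociatedGauge N (diagSeminorm N) where
  gauge :=
    { definite := fun x hx => by
        have h := hN.definite _ hx
        funext a
        have := rectDiag_apply_castLE x a
        rw [h, Matrix.zero_apply] at this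
        exact_mod_cast this.symm
      perm := fun x p => by
        obtain ⟨U, hU, V, hV, h⟩ := exists_unitary_rectDiag_perm x p
        rw [diagSeminorm_apply, h]
        exact hN.conj_eq _ hU hV
      abs := fun x => by
        obtain ⟨U, hU, h⟩ := exists_unitary_rectDiag_abs x
        have := hN.invariant (rectDiag r t x) U hU 1 (one_mem _)
        rwa [Matrix.mul_one, ← h] at this }
  eq_singVals := hN.eq_diagSeminorm_singVals

/-- The associated gauge is unique: it is forced by its values on diagonal matrices. -/
lemma IsAssociatedGauge.apply_eq {g : Seminorm ℝ (Fin (min r t) → ℝ)}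
    (hg : IsAssociatedGauge N g) (x : Fin (min r t) → ℝ) : g x = N (rectDiag r t x) := by
  obtain ⟨p, hp⟩ := exists_perm_singVals_rectDiag x
  rw [hg.eq_singVals, hp, hg.gauge.perm (fun i => |x i|) p, hg.gauge.abs]

end

/-! ### Continuity of the singular values -/

lemma isCompact_unitaryGroup (n : ℕ) :
    IsCompact (Matrix.unitaryGroup (Fin n) ℂ : Set (Matrix (Fin n) (Fin n) ℂ)) := by
  have h : IsCompact (Set.pi Set.univ fun _ => Set.pi Set.univ fun _ => Metric.closedBall 0 1 :
      Set (Fin n → Fin n → ℂ)) :=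
    isCompact_univ_pi fun _ => isCompact_univ_pi fun _ => isCompact_closedBall _ _
  refine IsCompact.of_isClosed_subset (X := Matrix (Fin n) (Fin n) ℂ) h ?_
    fun U hU i _ j _ => ?_
  · have : (Matrix.unitaryGroup (Fin n) ℂ : Set (Matrix (Fin n) (Fin n) ℂ))
        = (fun U : Matrix (Fin n) (Fin n) ℂ => U * Uᴴ) ⁻¹' {1} := by
      ext U; exact Matrix.mem_unitaryGroup_iff
    exact this ▸ isClosed_singleton.preimage (by fun_prop)
  · simpa using entry_norm_bound_of_unitary hU i j

/-- Along an ultrafilter, the unitary factors of a singular value decomposition converge by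
compactness, hence so do the singular values, and uniqueness identifies the limit. -/
lemma continuous_singVals {r t : ℕ} :
    Continuous (singVals : Matrix (Fin r) (Fin t) ℂ → Fin (min r t) → ℝ) := by
  rw [continuous_iff_ultrafilter]
  intro A F hF
  choose U hU V hV hA using fun A : Matrix (Fin r) (Fin t) ℂ => exists_svd A
  have hid : Filter.Tendsto (fun B : Matrix (Fin r) (Fin t) ℂ => B) F (nhds A) := hF
  obtain ⟨U', hU', hUU'⟩ := (isCompact_unitaryGroup r).ultrafilter_le_nhds (F.map U)
    (Filter.le_principal_iff.2 (Filter.mem_map.2 (Filter.univ_mem' hU)))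
  obtain ⟨V', hV', hVV'⟩ := (isCompact_unitaryGroup t).ultrafilter_le_nhds (F.map V)
    (Filter.le_principal_iff.2 (Filter.mem_map.2 (Filter.univ_mem' hV)))
  have hUt : Filter.Tendsto U F (nhds U') := hUU'
  have hVt : Filter.Tendsto V F (nhds V') := hVV'
  let φ : Matrix (Fin r) (Fin r) ℂ × Matrix (Fin r) (Fin t) ℂ × Matrix (Fin t) (Fin t) ℂ →
      Fin (min r t) → ℝ := fun q i => ((q.1ᴴ * q.2.1 * q.2.2)
        (Fin.castLE (min_le_left r t) i) (Fin.castLE (min_le_right r t) i)).re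
  have hφ : Continuous φ := by
    refine continuous_pi fun i => Complex.continuous_re.comp ?_
    exact Continuous.matrix_elem (by fun_prop) _ _
  have hs : ∀ B, φ (U B, B, V B) = singVals B := by
    intro B
    have e3 : (U B)ᴴ * B * V B = rectDiag r t (singVals B) :=
      conjTranspose_mul_mul_of_eq (hU B) (hV B) (hA B)
    funext i
    simp only [φ, e3, rectDiag_apply_castLE, Complex.ofReal_re]
  have ht : Filter.Tendsto singVals F (nhds (φ (U', A, V'))) := by
    have := (hφ.tendsto (U', A, V')).comp (hUt.prodMk_nhds (hid.prodMk_nhds hVt))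
    exact this.congr fun B => hs B
  have hti := tendsto_pi_nhds.1 ht
  have hanti : Antitone (φ (U', A, V')) := fun i j hij =>
    le_of_tendsto_of_tendsto' (hti j) (hti i) fun B => singVals_antitone B hij
  have hnonneg : 0 ≤ φ (U', A, V') := fun i => ge_of_tendsto' (hti i) fun B => singVals_nonneg B i
  have hAeq : A = U' * rectDiag r t (φ (U', A, V')) * V'ᴴ := by
    have hψ : Continuous fun q : Matrix (Fin r) (Fin r) ℂ × (Fin (min r t) → ℝ) ×
        Matrix (Fin t) (Fin t) ℂ => q.1 * rectDiag r t q.2.1 * q.2.2ᴴ := by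
      have := continuous_rectDiag (r := r) (t := t)
      fun_prop
    have h1 := (hψ.tendsto (U', φ (U', A, V'), V')).comp (hUt.prodMk_nhds (ht.prodMk_nhds hVt))
    exact tendsto_nhds_unique hid (h1.congr fun B => (hA B).symm)
  rw [singVals_eq_of_antitone hU' hV' hanti hnonneg hAeq]
  exact ht

/-! ### First-order perturbation of singular values -/

section
open Filter Asymptotics Topology

lemma Fintype.sum_eq_sum_comp_add {α β : Type*} [Fintype α] [Fintype β] {e : α → β}
    (he : Function.Injective e) [DecidablePred (· ∈ Set.range e)] (f : β → ℝ) :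
    ∑ j, f j = ∑ a, f (e a) + ∑ j, if j ∈ Set.range e then 0 else f j := by
  rw [Fintype.sum_of_injective e he (fun a => f (e a))
    (fun j => if j ∈ Set.range e then f j else 0) (fun j hj => if_neg hj)
    (fun a => (if_pos ⟨a, rfl⟩).symm), ← Finset.sum_add_distrib]
  refine Finset.sum_congr rfl fun j _ => ?_
  split_ifs <;> simp

/-- If `u w = O(s)` and `u → c`, then `w = O(s)` unless `c = 0`; in either case `c ‖w‖² = O(s²)`. -/
lemma isBigO_mul_norm_sq {l : Filter ℝ} {u : ℝ → ℝ} {w : ℝ → ℂ} {c : ℝ}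
    (hu : Tendsto u l (𝓝 c)) (h : (fun s => (u s : ℂ) * w s) =O[l] (fun s : ℝ => s)) :
    (fun s => c * ‖w s‖ ^ 2) =O[l] fun s : ℝ => s ^ 2 := by
  rcases eq_or_ne c 0 with rfl | hc
  · simpa using isBigO_zero _ _
  · have h1 : (fun s => ((u s)⁻¹ : ℂ)) =O[l] fun _ => (1 : ℝ) := by
      have : Tendsto (fun s => ((u s)⁻¹ : ℂ)) l (𝓝 ((c : ℂ)⁻¹)) :=
        ((Complex.continuous_ofReal.tendsto c).comp hu).inv₀ (by exact_mod_cast hc)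
      exact this.isBigO_one ℝ
    have h2 : w =O[l] fun s : ℝ => s := by
      refine ((h1.mul h).congr' ?_ ?_)
      · filter_upwards [hu.eventually_ne hc] with s hs
        have : (u s : ℂ) ≠ 0 := by exact_mod_cast hs
        field_simp
      · exact Eventually.of_forall fun s => one_mul s
    exact (h2.norm_left.pow 2).const_mul_left c

lemma exists_entry_bound {r t : ℕ} (E : Matrix (Fin r) (Fin t) ℂ) :
    ∃ K, ∀ U ∈ Matrix.unitaryGroup (Fin r) ℂ, ∀ V ∈ Matrix.unitaryGroup (Fin t) ℂ,
      ∀ i j, ‖(Uᴴ * E * V) i j‖ ≤ K := by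
  refine ⟨∑ b, ∑ a, ‖E a b‖, fun U hU V hV i j => ?_⟩
  rw [Matrix.mul_apply]
  refine (norm_sum_le _ _).trans (Finset.sum_le_sum fun b _ => ?_)
  rw [norm_mul, Matrix.mul_apply]
  refine (mul_le_of_le_one_right (norm_nonneg _) (entry_norm_bound_of_unitary hV _ _)).trans ?_
  refine (norm_sum_le _ _).trans (Finset.sum_le_sum fun a _ => ?_)
  rw [norm_mul]
  exact mul_le_of_le_one_left (norm_nonneg _)
    (entry_norm_bound_of_unitary (U := Uᴴ) (Unitary.star_mem hU) _ _)

lemma sum_norm_sq_row {n : ℕ} {W : Matrix (Fin n) (Fin n) ℂ}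
    (hW : W ∈ Matrix.unitaryGroup (Fin n) ℂ) (i : Fin n) : ∑ j, ‖W i j‖ ^ 2 = 1 := by
  have h : (W * Wᴴ) i i = 1 := by
    rw [show W * Wᴴ = 1 from Matrix.mem_unitaryGroup_iff.1 hW, Matrix.one_apply_eq]
  rw [Matrix.mul_apply] at h
  have h2 : ∀ j, W i j * Wᴴ j i = ((‖W i j‖ ^ 2 : ℝ) : ℂ) := by
    intro j
    rw [Matrix.conjTranspose_apply, Complex.star_def, Complex.mul_conj']
    simp
  simp only [h2] at h
  exact_mod_cast h

/-- With `p = σᵢ`, `q = σⱼ` and `w`, `z` entries of the transition matrices, this splits the deviation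
of the diagonal from `σᵢ` into the two squares that the perturbation equations control. -/
lemma sub_mul_add_mul_norm_sq (p q : ℝ) (w z : ℂ) :
    (q * (w * star z)).re - p / 2 * (‖w‖ ^ 2 + ‖z‖ ^ 2)
      = -(1 / 4) * ((p - q) * ‖w + z‖ ^ 2 + (p + q) * ‖w - z‖ ^ 2) := by
  simp only [← Complex.normSq_eq_norm_sq, Complex.normSq_apply, Complex.add_re, Complex.add_im,
    Complex.sub_re, Complex.sub_im, Complex.mul_re, Complex.mul_im, Complex.star_def,
    Complex.conj_re, Complex.conj_im, Complex.ofReal_re, Complex.ofReal_im]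
  ring

lemma mul_transition_sub_transition_mul {r t : ℕ} {A B : Matrix (Fin r) (Fin t) ℂ}
    {U U₀ : Matrix (Fin r) (Fin r) ℂ} (hU : U ∈ Matrix.unitaryGroup (Fin r) ℂ)
    {V V₀ : Matrix (Fin t) (Fin t) ℂ}
    (hV₀ : V₀ ∈ Matrix.unitaryGroup (Fin t) ℂ) {D D₀ : Matrix (Fin r) (Fin t) ℂ}
    (hB : B = U * D * Vᴴ) (hA : A = U₀ * D₀ * V₀ᴴ) :
    D * (Vᴴ * V₀) - Uᴴ * U₀ * D₀ = Uᴴ * (B - A) * V₀ := by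
  have e1 : Uᴴ * U = 1 := Matrix.mem_unitaryGroup_iff'.1 hU
  have e2 : V₀ᴴ * V₀ = 1 := Matrix.mem_unitaryGroup_iff'.1 hV₀
  have h1 : Uᴴ * B * V₀ = D * (Vᴴ * V₀) := by
    rw [hB, Matrix.mul_assoc U, ← Matrix.mul_assoc Uᴴ, e1, Matrix.one_mul, Matrix.mul_assoc]
  have h2 : Uᴴ * A * V₀ = Uᴴ * U₀ * D₀ := by
    rw [hA, ← Matrix.mul_assoc, Matrix.mul_assoc _ V₀ᴴ, e2, Matrix.mul_one, Matrix.mul_assoc Uᴴ]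
  rw [Matrix.mul_sub, Matrix.sub_mul, h1, h2]

/-- Singular frames of `A + sE` diagonalise `A` up to an error of second order in `s`: their
transition matrices to singular frames of `A` have entries of order `s` between different singular
values, and the diagonal depends only on the squares of these. -/
lemma diag_sub_singVals_isBigO {r t : ℕ} (A E : Matrix (Fin r) (Fin t) ℂ)
    {U : ℝ → Matrix (Fin r) (Fin r) ℂ} (hU : ∀ s, U s ∈ Matrix.unitaryGroup (Fin r) ℂ)
    {V : ℝ → Matrix (Fin t) (Fin t) ℂ} (hV : ∀ s, V s ∈ Matrix.unitaryGroup (Fin t) ℂ)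
    (hUV : ∀ s : ℝ, A + (s : ℂ) • E = U s * rectDiag r t (singVals (A + (s : ℂ) • E)) * (V s)ᴴ)
    (i : Fin (min r t)) :
    (fun s => (((U s)ᴴ * A * V s) (Fin.castLE (min_le_left r t) i)
      (Fin.castLE (min_le_right r t) i)).re - singVals A i) =O[𝓝 0] fun s : ℝ => s ^ 2 := by
  classical
  obtain ⟨U₀, hU₀, V₀, hV₀, hA⟩ := exists_svd A
  obtain ⟨K, hK⟩ := exists_entry_bound E
  set c := Fin.castLE (min_le_left r t) with hc
  set c' := Fin.castLE (min_le_right r t) with hc'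
  set σ := singVals A with hσ
  set τ : ℝ → Fin (min r t) → ℝ := fun s => singVals (A + (s : ℂ) • E)
  have hτ : ∀ a, Tendsto (fun s => τ s a) (𝓝 0) (𝓝 (σ a)) := by
    have h1 : Continuous fun s : ℝ => A + (s : ℂ) • E := by fun_prop
    have h2 := (continuous_singVals.comp h1).tendsto 0
    simp only [Function.comp_apply, Complex.ofReal_zero, zero_smul, add_zero] at h2
    exact fun a => tendsto_pi_nhds.1 h2 a
  -- the transition matrices between the two pairs of frames
  set W : ℝ → Matrix (Fin r) (Fin r) ℂ := fun s => (U s)ᴴ * U₀ with hW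
  set Z : ℝ → Matrix (Fin t) (Fin t) ℂ := fun s => (V s)ᴴ * V₀ with hZ
  have hWu : ∀ s, W s ∈ Matrix.unitaryGroup (Fin r) ℂ :=
    fun s => mul_mem (Unitary.star_mem (hU s)) hU₀
  have hZu : ∀ s, Z s ∈ Matrix.unitaryGroup (Fin t) ℂ :=
    fun s => mul_mem (Unitary.star_mem (hV s)) hV₀
  have hO : ∀ {f : ℝ → ℂ}, (∀ s, ‖f s‖ ≤ |s| * K) → f =O[𝓝 0] fun s : ℝ => s := by
    intro f hf
    refine IsBigO.of_bound K (Eventually.of_forall fun s => ?_)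
    rw [mul_comm, Real.norm_eq_abs]
    exact hf s
  have eq1 : ∀ s, rectDiag r t (τ s) * Z s - W s * rectDiag r t σ
      = (s : ℂ) • ((U s)ᴴ * E * V₀) := by
    intro s
    refine (mul_transition_sub_transition_mul (hU s) hV₀ (hUV s) hA).trans ?_
    rw [add_sub_cancel_left, Matrix.mul_smul, Matrix.smul_mul]
  have eq2 : ∀ s, (W s)ᴴ * rectDiag r t (τ s) - rectDiag r t σ * (Z s)ᴴ
      = (s : ℂ) • (U₀ᴴ * E * V s) := by
    intro s
    have hWs : (W s)ᴴ = U₀ᴴ * U s := by simp [W]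
    have hZs : (Z s)ᴴ = V₀ᴴ * V s := by simp [Z]
    rw [hWs, hZs, ← neg_sub, mul_transition_sub_transition_mul hU₀ (hV s) hA (hUV s),
      sub_add_cancel_left, Matrix.mul_neg, Matrix.neg_mul, neg_neg, Matrix.mul_smul,
      Matrix.smul_mul]
  have b1 : ∀ p q, (fun s => (rectDiag r t (τ s) * Z s - W s * rectDiag r t σ) p q)
      =O[𝓝 0] fun s : ℝ => s := fun p q => hO fun s => by
    rw [eq1, Matrix.smul_apply, norm_smul, Complex.norm_real, Real.norm_eq_abs]
    exact mul_le_mul_of_nonneg_left (hK _ (hU s) _ hV₀ p q) (abs_nonneg s)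
  have b2 : ∀ p q, (fun s => star (((W s)ᴴ * rectDiag r t (τ s) - rectDiag r t σ * (Z s)ᴴ) p q))
      =O[𝓝 0] fun s : ℝ => s := fun p q => hO fun s => by
    rw [eq2, norm_star, Matrix.smul_apply, norm_smul, Complex.norm_real, Real.norm_eq_abs]
    exact mul_le_mul_of_nonneg_left (hK _ hU₀ _ (hV s) p q) (abs_nonneg s)
  have key1 : ∀ a s, (rectDiag r t (τ s) * Z s - W s * rectDiag r t σ) (c i) (c' a)
      = τ s i * Z s (c' i) (c' a) - W s (c i) (c a) * σ a := fun a s => by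
    rw [Matrix.sub_apply, rectDiag_mul_apply_castLE, mul_rectDiag_apply_castLE]
  have key2 : ∀ a s, star (((W s)ᴴ * rectDiag r t (τ s) - rectDiag r t σ * (Z s)ᴴ) (c a) (c' i))
      = τ s i * W s (c i) (c a) - Z s (c' i) (c' a) * σ a := fun a s => by
    rw [Matrix.sub_apply, rectDiag_mul_apply_castLE, mul_rectDiag_apply_castLE]
    simp [mul_comm, hc, hc']
  -- adding and subtracting the two perturbation equations decouples `W + Z` from `W - Z`
  have bplus : ∀ a, (fun s => (σ i - σ a) * ‖W s (c i) (c a) + Z s (c' i) (c' a)‖ ^ 2)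
      =O[𝓝 0] fun s : ℝ => s ^ 2 := by
    intro a
    refine isBigO_mul_norm_sq (u := fun s => τ s i - σ a) ((hτ i).sub_const _) ?_
    refine ((b1 (c i) (c' a)).add (b2 (c a) (c' i))).congr_left fun s => ?_
    rw [key1, key2]; push_cast; ring
  have bminus : ∀ a, (fun s => (σ i + σ a) * ‖W s (c i) (c a) - Z s (c' i) (c' a)‖ ^ 2)
      =O[𝓝 0] fun s : ℝ => s ^ 2 := by
    intro a
    refine isBigO_mul_norm_sq (u := fun s => τ s i + σ a) ((hτ i).add_const _) ?_
    refine ((b2 (c a) (c' i)).sub (b1 (c i) (c' a))).congr_left fun s => ?_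
    rw [key1, key2]; push_cast; ring
  -- beyond the first `min r t` columns each equation has a single term
  have bW : ∀ j, (fun s => if j ∈ Set.range c then 0 else σ i * ‖W s (c i) j‖ ^ 2)
      =O[𝓝 0] fun s : ℝ => s ^ 2 := by
    intro j
    split_ifs with hj
    · exact isBigO_zero _ _
    · refine isBigO_mul_norm_sq (hτ i) ((b2 j (c' i)).congr_left fun s => ?_)
      rw [Matrix.sub_apply, rectDiag_mul_apply_of_notMem _ _ hj, mul_rectDiag_apply_castLE]
      simp [mul_comm, hc]
  have bZ : ∀ j, (fun s => if j ∈ Set.range c' then 0 else σ i * ‖Z s (c' i) j‖ ^ 2)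
      =O[𝓝 0] fun s : ℝ => s ^ 2 := by
    intro j
    split_ifs with hj
    · exact isBigO_zero _ _
    · refine isBigO_mul_norm_sq (hτ i) ((b1 (c i) j).congr_left fun s => ?_)
      rw [Matrix.sub_apply, mul_rectDiag_apply_of_notMem _ _ _ hj, rectDiag_mul_apply_castLE,
        sub_zero]
  have main := (((IsBigO.sum fun a (_ : a ∈ Finset.univ) => (bplus a).add (bminus a)).const_mul_left
    (-(1 / 4))).sub ((IsBigO.sum fun j (_ : j ∈ Finset.univ) => bW j).const_mul_left (1 / 2))).sub
    ((IsBigO.sum fun j (_ : j ∈ Finset.univ) => bZ j).const_mul_left (1 / 2))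
  refine main.congr_left fun s => ?_
  have hcinj : Function.Injective c := Fin.castLE_injective _
  have hcinj' : Function.Injective c' := Fin.castLE_injective _
  have hd : (((U s)ᴴ * A * V s) (c i) (c' i)).re
      = ∑ a, (σ a * (W s (c i) (c a) * star (Z s (c' i) (c' a)))).re := by
    have h1 : (U s)ᴴ * A * V s = (W s * rectDiag r t σ) * (Z s)ᴴ := by
      conv_lhs => rw [hA]
      simp only [hW, hZ, Matrix.conjTranspose_mul, Matrix.conjTranspose_conjTranspose,
        Matrix.mul_assoc]
    rw [h1, Matrix.mul_apply, ← Complex.re_sum]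
    congr 1
    refine (Fintype.sum_of_injective c' hcinj' _ _ (fun j hj => ?_) fun a => ?_).symm
    · rw [mul_rectDiag_apply_of_notMem _ _ _ hj, zero_mul]
    · rw [mul_rectDiag_apply_castLE, Matrix.conjTranspose_apply]; ring
  have hWs := sum_norm_sq_row (hWu s) (c i)
  have hZs := sum_norm_sq_row (hZu s) (c' i)
  rw [Fintype.sum_eq_sum_comp_add hcinj] at hWs
  rw [Fintype.sum_eq_sum_comp_add hcinj'] at hZs
  have e3 : ∀ (n : ℕ) (P : Fin n → Prop) [DecidablePred P] (f : Fin n → ℝ),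
      ∑ j, (if P j then 0 else σ i * f j) = σ i * ∑ j, if P j then 0 else f j := by
    intro n P _ f
    rw [Finset.mul_sum]
    refine Finset.sum_congr rfl fun j _ => ?_
    split_ifs <;> simp
  simp only [Finset.sum_apply]
  rw [e3, e3, hd, Finset.mul_sum]
  simp only [← sub_mul_add_mul_norm_sq]
  rw [Finset.sum_sub_distrib, ← Finset.mul_sum, Finset.sum_add_distrib]
  linear_combination (σ i / 2) * (hWs + hZs) * (-1)

end

/-! ### Mirsky's inequality -/

section
open Filter Asymptotics Topology

lemma Seminorm.exists_le_mul_norm {k : ℕ} (g : Seminorm ℝ (Fin k → ℝ)) :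
    ∃ C, 0 ≤ C ∧ ∀ x, g x ≤ C * ‖x‖ := by
  refine ⟨∑ i, g (Pi.single i 1), Finset.sum_nonneg fun i _ => apply_nonneg g _, fun x => ?_⟩
  have hx : x = ∑ i, x i • (Pi.single i 1 : Fin k → ℝ) := by
    simp [← Pi.single_smul, Finset.univ_sum_single]
  calc g x = g (∑ i, x i • (Pi.single i 1 : Fin k → ℝ)) := by rw [← hx]
    _ ≤ ∑ i, g (x i • (Pi.single i 1 : Fin k → ℝ)) := 
        Finset.le_sum_of_subadditive g (map_zero g).le (map_add_le_add g) _ _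
    _ ≤ ∑ i, g (Pi.single i 1) * ‖x‖ := by
        refine Finset.sum_le_sum fun i _ => ?_
        rw [map_smul_eq_mul, mul_comm]
        exact mul_le_mul_of_nonneg_left (norm_le_pi_norm x i) (apply_nonneg g _)
    _ = _ := by rw [Finset.sum_mul]

lemma Seminorm.continuous_pi_fin {k : ℕ} (g : Seminorm ℝ (Fin k → ℝ)) : Continuous g := by
  obtain ⟨C, hC, h⟩ := g.exists_le_mul_norm
  refine Seminorm.continuous_of_le (q := C.toNNReal • normSeminorm ℝ (Fin k → ℝ)) ?_ fun x => ?_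
  · exact continuous_const.mul continuous_norm
  · change g x ≤ (C.toNNReal : ℝ) * ‖x‖
    rw [Real.coe_toNNReal _ hC]
    exact h x

variable {r t : ℕ} {N : Seminorm ℂ (Matrix (Fin r) (Fin t) ℂ)}

/-- The singular values move along a line with speed at most `N E`, up to a second order error:
the first-order part is the diagonal of `E` in singular frames, which pinching controls. -/
lemma IsUnitarilyInvariantNorm.eventually_singVals_sub_lt (hN : IsUnitarilyInvariantNorm N)
    (A E : Matrix (Fin r) (Fin t) ℂ) {ρ : ℝ} (hρ : N E < ρ) :
    ∀ᶠ s : ℝ in 𝓝[>] 0,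
      diagSeminorm N (singVals (A + (s : ℂ) • E) - singVals A) < s * ρ := by
  choose U hU V hV hUV using fun s : ℝ => exists_svd (A + (s : ℂ) • E)
  let δ : ℝ → Fin (min r t) → ℝ := fun s i =>
    (((U s)ᴴ * A * V s) (Fin.castLE (min_le_left r t) i)
      (Fin.castLE (min_le_right r t) i)).re - singVals A i
  have hδ : δ =O[𝓝 0] fun s : ℝ => s ^ 2 :=
    isBigO_pi.2 fun i => diag_sub_singVals_isBigO A E hU hV hUV i
  obtain ⟨C, hC, hg⟩ := (diagSeminorm N).exists_le_mul_norm
  have hlo : (fun s => C * ‖δ s‖) =o[𝓝 0] fun s : ℝ => s :=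
    (hδ.norm_left.const_mul_left C).trans_isLittleO
      (by simpa using isLittleO_pow_pow (𝕜 := ℝ) (one_lt_two))
  have hη : 0 < (ρ - N E) / 2 := by linarith
  filter_upwards [nhdsWithin_le_nhds (hlo.bound hη), self_mem_nhdsWithin] with s hs hs0
  have hs0 : 0 < s := hs0
  let e : Fin (min r t) → ℝ := fun i =>
    (((U s)ᴴ * E * V s) (Fin.castLE (min_le_left r t) i) (Fin.castLE (min_le_right r t) i)).re
  have hdec : singVals (A + (s : ℂ) • E) - singVals A = s • e + δ s := by
    funext i
    have h1 := conjTranspose_mul_mul_of_eq (hU s) (hV s) (hUV s)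
    have h2 := rectDiag_apply_castLE (singVals (A + (s : ℂ) • E)) i
    rw [← h1, Matrix.mul_add, Matrix.add_mul, Matrix.mul_smul, Matrix.smul_mul, Matrix.add_apply,
      Matrix.smul_apply] at h2
    have h3 := congrArg Complex.re h2
    rw [Complex.add_re, smul_eq_mul, Complex.re_ofReal_mul, Complex.ofReal_re] at h3
    simp only [Pi.sub_apply, Pi.add_apply, Pi.smul_apply, smul_eq_mul, e, δ]
    linarith
  have he : diagSeminorm N e ≤ N E := by
    have h1 := hN.pinching_le ((U s)ᴴ * E * V s)
    have h2 := hN.invariant E _ (Unitary.star_mem (hU s)) _ (hV s)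
    exact h1.trans h2.le
  have h4 : C * ‖δ s‖ ≤ (ρ - N E) / 2 * s := by
    have := (le_abs_self _).trans hs
    rwa [Real.norm_eq_abs, abs_of_pos hs0] at this
  calc diagSeminorm N (singVals (A + (s : ℂ) • E) - singVals A)
      ≤ diagSeminorm N (s • e) + diagSeminorm N (δ s) := by rw [hdec]; exact map_add_le_add _ _ _
    _ ≤ s * N E + (ρ - N E) / 2 * s := by
        refine add_le_add ?_ ((hg _).trans h4)
        rw [map_smul_eq_mul, Real.norm_eq_abs, abs_of_pos hs0]
        exact mul_le_mul_of_nonneg_left he hs0.le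
    _ < s * ρ := by nlinarith

/-- **Mirsky's inequality**: passing to ordered singular values is a contraction for every
unitarily invariant norm. -/
theorem IsUnitarilyInvariantNorm.singVals_sub_le (hN : IsUnitarilyInvariantNorm N)
    (A B : Matrix (Fin r) (Fin t) ℂ) :
    diagSeminorm N (singVals B - singVals A) ≤ N (B - A) := by
  set E := B - A with hE
  let f : ℝ → ℝ := fun s => diagSeminorm N (singVals (A + (s : ℂ) • E) - singVals A)
  have hf : Continuous f := by
    refine (diagSeminorm N).continuous_pi_fin.comp
      ((continuous_singVals.comp (?_ : Continuous fun s : ℝ => A + (s : ℂ) • E)).sub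
        continuous_const)
    fun_prop
  have h := image_le_of_liminf_slope_right_le_deriv_boundary (f := f) (a := 0) (b := 1)
    (B := fun s => s * N E) (B' := fun _ => N E) hf.continuousOn
    (by simp [f]) (by fun_prop)
    (fun x _ => by simpa using ((hasDerivAt_id x).mul_const (N E)).hasDerivWithinAt)
    (fun x _ ρ hρ => by
      have h1 := hN.eventually_singVals_sub_lt (A + (x : ℂ) • E) E hρ
      have h2 : Tendsto (fun z : ℝ => z - x) (𝓝[>] x) (𝓝[>] 0) := by
        refine tendsto_nhdsWithin_iff.2 ⟨?_, ?_⟩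
        · have : Tendsto (fun z : ℝ => z - x) (𝓝 x) (𝓝 (x - x)) :=
            (continuous_id.sub continuous_const).tendsto x
          rw [sub_self] at this
          exact this.mono_left nhdsWithin_le_nhds
        · filter_upwards [self_mem_nhdsWithin] with z hz
          exact sub_pos.2 (Set.mem_Ioi.1 hz)
      refine Eventually.frequently ?_
      filter_upwards [h2.eventually h1, self_mem_nhdsWithin] with z hz hzx
      have hzx' : 0 < z - x := sub_pos.2 (Set.mem_Ioi.1 hzx)
      rw [slope_def_field, div_lt_iff₀ hzx']
      have e1 : A + (x : ℂ) • E + ((z - x : ℝ) : ℂ) • E = A + (z : ℂ) • E := by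
        rw [add_assoc, ← add_smul]; push_cast; ring_nf
      rw [e1] at hz
      have h3 : f z ≤ diagSeminorm N (singVals (A + (z : ℂ) • E) - singVals (A + (x : ℂ) • E))
          + f x := by
        have := map_add_le_add (diagSeminorm N)
          (singVals (A + (z : ℂ) • E) - singVals (A + (x : ℂ) • E))
          (singVals (A + (x : ℂ) • E) - singVals A)
        rwa [sub_add_sub_cancel] at this
      linarith)
    (Set.right_mem_Icc.2 zero_le_one)
  simpa [f, hE] using h

end

/-! ### Hadamard's inequality and the mutual information -/

/-- **Hadamard's inequality** for positive definite matrices. After scaling the diagonal to `1`,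
it is `∏ λᵢ ≤ ∏ exp (λᵢ - 1) = exp (trace - n) = 1`. -/
lemma Matrix.PosDef.det_re_le_prod_diag {n : ℕ} {M : Matrix (Fin n) (Fin n) ℂ} (hM : M.PosDef) :
    M.det.re ≤ ∏ i, (M i i).re := by
  have hd : ∀ i, 0 < (M i i).re := fun i => (Complex.lt_def.1 (hM.diag_pos (i := i))).1
  have him : ∀ i, M i i = ((M i i).re : ℂ) := fun i =>
    Complex.ext rfl (by simpa using (Complex.lt_def.1 (hM.diag_pos (i := i))).2.symm)
  let D : Matrix (Fin n) (Fin n) ℂ := Matrix.diagonal fun i => (((√(M i i).re)⁻¹ : ℝ) : ℂ)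
  have hDD : Dᴴ = D := by
    simp only [D, Matrix.diagonal_conjTranspose]
    congr 1; funext i; simp
  have hP : (D * M * Dᴴ).PosSemidef := hM.posSemidef.mul_mul_conjTranspose_same D
  have hPd : ∀ i, (D * M * Dᴴ) i i = 1 := by
    intro i
    rw [hDD]
    simp only [D, Matrix.mul_diagonal, Matrix.diagonal_mul]
    rw [him i, ← Complex.ofReal_mul, ← Complex.ofReal_mul]
    have h1 : √(M i i).re ≠ 0 := (Real.sqrt_pos.2 (hd i)).ne'
    have h2 := Real.mul_self_sqrt (hd i).le
    rw [← Complex.ofReal_one, Complex.ofReal_inj, Complex.ofReal_re]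
    field_simp
    rw [sq, h2]
  have htr : ∑ i, hP.isHermitian.eigenvalues i = n := by
    have h1 := hP.isHermitian.trace_eq_sum_eigenvalues
    simp only [Matrix.trace, Matrix.diag_apply, hPd] at h1
    have h2 : ((∑ i, hP.isHermitian.eigenvalues i : ℝ) : ℂ) = ((n : ℝ) : ℂ) := by
      push_cast; simpa using h1.symm
    exact_mod_cast h2
  have hdet : (D * M * Dᴴ).det.re ≤ 1 := by
    have h1 : (D * M * Dᴴ).det.re = ∏ i, hP.isHermitian.eigenvalues i := by
      have := hP.isHermitian.det_eq_prod_eigenvalues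
      rw [this]
      change (∏ i, ((hP.isHermitian.eigenvalues i : ℝ) : ℂ)).re = _
      rw [← Complex.ofReal_prod, Complex.ofReal_re]
    rw [h1]
    calc ∏ i, hP.isHermitian.eigenvalues i
        ≤ ∏ i, Real.exp (hP.isHermitian.eigenvalues i - 1) :=
          Finset.prod_le_prod (fun i _ => hP.eigenvalues_nonneg i) fun i _ => by
            have := Real.add_one_le_exp (hP.isHermitian.eigenvalues i - 1)
            linarith
      _ = 1 := by rw [← Real.exp_sum, Finset.sum_sub_distrib, htr]; simp
  have hdet2 : (D * M * Dᴴ).det.re = (∏ i, (M i i).re)⁻¹ * M.det.re := by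
    have h1 : D.det * D.det = (((∏ i, (M i i).re)⁻¹ : ℝ) : ℂ) := by
      rw [Matrix.det_diagonal, ← Complex.ofReal_prod, ← Complex.ofReal_mul,
        ← Finset.prod_mul_distrib, ← Finset.prod_inv_distrib]
      congr 1
      refine Finset.prod_congr rfl fun i _ => ?_
      rw [← mul_inv, Real.mul_self_sqrt (hd i).le]
    rw [hDD, Matrix.det_mul, Matrix.det_mul, mul_right_comm, h1, Complex.re_ofReal_mul]
  rw [hdet2, inv_mul_le_one₀ (Finset.prod_pos fun i _ => hd i)] at hdet
  exact hdet

section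
variable {r t : ℕ}

/-- Unitary factors cancel in the determinant defining the mutual information. -/
lemma mutualInfo_conj (γ : ℝ) {U : Matrix (Fin r) (Fin r) ℂ}
    (hU : U ∈ Matrix.unitaryGroup (Fin r) ℂ) (D : Matrix (Fin r) (Fin t) ℂ)
    (V Q : Matrix (Fin t) (Fin t) ℂ) :
    mutualInfo γ (U * D * Vᴴ) Q = mutualInfo γ D (Vᴴ * Q * V) := by
  have e : U * Uᴴ = 1 := Matrix.mem_unitaryGroup_iff.1 hU
  have h : 1 + (γ : ℂ) • (U * D * Vᴴ * Q * (U * D * Vᴴ)ᴴ)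
      = U * (1 + (γ : ℂ) • (D * (Vᴴ * Q * V) * Dᴴ)) * Uᴴ := by
    rw [Matrix.mul_add, Matrix.add_mul, Matrix.mul_one, e, Matrix.mul_smul, Matrix.smul_mul]
    simp only [Matrix.conjTranspose_mul, Matrix.conjTranspose_conjTranspose, Matrix.mul_assoc]
  rw [mutualInfo, mutualInfo, h, Matrix.det_mul, Matrix.det_mul, mul_right_comm, ← Matrix.det_mul,
    e, Matrix.det_one, one_mul]

lemma rectDiag_mul_mul_diag_castLE (x : Fin (min r t) → ℝ) (Q : Matrix (Fin t) (Fin t) ℂ)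
    (a : Fin (min r t)) :
    (rectDiag r t x * Q * (rectDiag r t x)ᴴ) (Fin.castLE (min_le_left r t) a)
      (Fin.castLE (min_le_left r t) a)
      = x a ^ 2 * Q (Fin.castLE (min_le_right r t) a) (Fin.castLE (min_le_right r t) a) := by
  rw [Matrix.mul_assoc, rectDiag_mul_apply_castLE]
  have h : (Q * (rectDiag r t x)ᴴ) (Fin.castLE (min_le_right r t) a)
      (Fin.castLE (min_le_left r t) a)
      = star ((rectDiag r t x * Qᴴ) (Fin.castLE (min_le_left r t) a)
        (Fin.castLE (min_le_right r t) a)) := by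
    rw [← Matrix.conjTranspose_apply, Matrix.conjTranspose_mul, Matrix.conjTranspose_conjTranspose]
  rw [h, rectDiag_mul_apply_castLE]
  simp
  ring

/-- The diagonal entries of `1 + γ D Q Dᴴ` beyond the first `min r t` are `1`. -/
lemma prod_diag_one_add (γ : ℝ) (x : Fin (min r t) → ℝ) (Q : Matrix (Fin t) (Fin t) ℂ) :
    ∏ i, ((1 + (γ : ℂ) • (rectDiag r t x * Q * (rectDiag r t x)ᴴ) :
      Matrix (Fin r) (Fin r) ℂ) i i).re
      = ∏ a : Fin (min r t), (1 + γ * x a ^ 2 *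
        (Q (Fin.castLE (min_le_right r t) a) (Fin.castLE (min_le_right r t) a)).re) := by
  refine (Fintype.prod_of_injective (Fin.castLE (min_le_left r t)) (Fin.castLE_injective _) _ _
    (fun i hi => ?_) fun a => ?_).symm
  · rw [Matrix.add_apply, Matrix.smul_apply, Matrix.mul_assoc,
      rectDiag_mul_apply_of_notMem _ _ hi]
    simp
  · rw [Matrix.add_apply, Matrix.smul_apply, rectDiag_mul_mul_diag_castLE, Matrix.one_apply_eq,
      smul_eq_mul, Complex.add_re, Complex.re_ofReal_mul, ← Complex.ofReal_pow,
      Complex.re_ofReal_mul, Complex.one_re]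
    ring

lemma scalarInfo_eq_log_prod {γ : ℝ} (hγ : 0 ≤ γ) (x : Fin (min r t) → ℝ) {l : Fin t → ℝ}
    (hl : 0 ≤ l) : scalarInfo γ x l
      = Real.log (∏ a, (1 + γ * x a ^ 2 * l (Fin.castLE (min_le_right r t) a))) := by
  rw [scalarInfo, Real.log_prod]
  intro a _
  have := hl (Fin.castLE (min_le_right r t) a)
  simp only [Pi.zero_apply] at this
  positivity

lemma posDef_one_add {γ : ℝ} (hγ : 0 ≤ γ) (D : Matrix (Fin r) (Fin t) ℂ)
    {Q : Matrix (Fin t) (Fin t) ℂ} (hQ : Q.PosSemidef) :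
    (1 + (γ : ℂ) • (D * Q * Dᴴ)).PosDef :=
  Matrix.PosDef.one.add_posSemidef
    ((hQ.mul_mul_conjTranspose_same D).smul (by exact_mod_cast hγ))

lemma posSemidef_sqDiag_iff {l : Fin t → ℝ} : (sqDiag l).PosSemidef ↔ 0 ≤ l := by
  rw [sqDiag, Matrix.posSemidef_diagonal_iff]
  exact forall_congr' fun i => by simp

/-- Only the diagonal of the input covariance matters for an upper bound on the mutual information
of a diagonal channel. -/
lemma mutualInfo_rectDiag_le {γ : ℝ} (hγ : 0 ≤ γ) (x : Fin (min r t) → ℝ)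
    {Q : Matrix (Fin t) (Fin t) ℂ} (hQ : Q.PosSemidef) :
    mutualInfo γ (rectDiag r t x) Q ≤ scalarInfo γ x fun i => (Q i i).re := by
  rw [scalarInfo_eq_log_prod hγ x fun i => (Complex.le_def.1 (hQ.diag_nonneg (i := i))).1,
    ← prod_diag_one_add, mutualInfo]
  have hP := posDef_one_add hγ (rectDiag r t x) hQ
  exact Real.log_le_log (Complex.lt_def.1 hP.det_pos).1 hP.det_re_le_prod_diag

lemma mutualInfo_rectDiag_sqDiag {γ : ℝ} (hγ : 0 ≤ γ) (x : Fin (min r t) → ℝ) {l : Fin t → ℝ}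
    (hl : 0 ≤ l) : mutualInfo γ (rectDiag r t x) (sqDiag l) = scalarInfo γ x l := by
  set M := 1 + (γ : ℂ) • (rectDiag r t x * sqDiag l * (rectDiag r t x)ᴴ) with hMdef
  have hM : M.PosDef := posDef_one_add hγ _ (posSemidef_sqDiag_iff.2 hl)
  have hoff : ∀ i j, i ≠ j → M i j = 0 := by
    intro i j hij
    rw [hMdef, Matrix.add_apply, Matrix.one_apply_ne hij, Matrix.smul_apply, Matrix.mul_apply,
      Finset.sum_eq_zero, smul_zero, add_zero]
    intro b _
    rw [sqDiag, Matrix.mul_diagonal, Matrix.conjTranspose_apply]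
    by_cases hb : (i : ℕ) = b
    · have : ¬ ((j : ℕ) = b) := fun h => hij (Fin.ext (hb.trans h.symm))
      simp [rectDiag, this]
    · simp [rectDiag, hb]
  have hdiag : M = Matrix.diagonal fun i => ((M i i).re : ℂ) := by
    ext i j
    by_cases hij : i = j
    · subst hij
      rw [Matrix.diagonal_apply_eq]
      exact Complex.ext rfl (by simpa using (Complex.lt_def.1 (hM.diag_pos (i := i))).2.symm)
    · rw [hoff i j hij, Matrix.diagonal_apply_ne _ hij]
  have hdet : M.det.re = ∏ i, (M i i).re := by
    conv_lhs => rw [hdiag]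
    rw [Matrix.det_diagonal, ← Complex.ofReal_prod, Complex.ofReal_re]
  rw [mutualInfo, ← hMdef, hdet, scalarInfo_eq_log_prod hγ x hl, hMdef, prod_diag_one_add]
  simp [sqDiag]

end

/-! ### Eigenvalue regions -/

section
variable {t : ℕ} {S : Set (Matrix (Fin t) (Fin t) ℂ)}

lemma exists_unitary_sqDiag_perm (l : Fin t → ℝ) (p : Equiv.Perm (Fin t)) :
    ∃ V ∈ Matrix.unitaryGroup (Fin t) ℂ, sqDiag (fun i => l (p i)) = V * sqDiag l * Vᴴ := by
  refine ⟨_, permMatrix_mem_unitaryGroup p, ?_⟩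
  have h : sqDiag (fun i => l (p i)) = (sqDiag l).submatrix p p :=
    (Matrix.submatrix_diagonal_equiv (fun i => ((l i : ℝ) : ℂ)) p).symm
  rw [h]
  ext i j
  simp [Matrix.mul_apply, Matrix.one_apply]

namespace IsPowerConstraint

lemma conj_mem_iff (hS : IsPowerConstraint S) {V : Matrix (Fin t) (Fin t) ℂ}
    (hV : V ∈ Matrix.unitaryGroup (Fin t) ℂ) (Q : Matrix (Fin t) (Fin t) ℂ) :
    V * Q * Vᴴ ∈ S ↔ Q ∈ S := by
  refine ⟨fun h => ?_, fun h => hS.conj_mem Q h V hV⟩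
  have h1 := hS.conj_mem _ h Vᴴ (Unitary.star_mem hV)
  rwa [Matrix.conjTranspose_conjTranspose, conjTranspose_mul_mul_of_eq hV hV rfl] at h1

lemma sqDiag_perm_mem_iff (hS : IsPowerConstraint S) (l : Fin t → ℝ) (p : Equiv.Perm (Fin t)) :
    sqDiag (fun i => l (p i)) ∈ S ↔ sqDiag l ∈ S := by
  obtain ⟨V, hV, h⟩ := exists_unitary_sqDiag_perm l p
  rw [h, hS.conj_mem_iff hV]

lemma sqDiag_re_diag_mem (hS : IsPowerConstraint S) {Q : Matrix (Fin t) (Fin t) ℂ} (hQ : Q ∈ S) :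
    sqDiag (fun i => (Q i i).re) ∈ S := by
  have h : sqDiag (fun i => (Q i i).re) = Matrix.diagonal Q.diag := by
    rw [sqDiag]
    congr 1
    funext i
    exact Complex.ext rfl
      (by simpa using (Complex.le_def.1 ((hS.posSemidef Q hQ).diag_nonneg (i := i))).2)
  exact h ▸ hS.diag_mem Q hQ

/-- Closure under taking diagonal parts makes the diagonal elements of the constraint set its
image under a linear map, so that they inherit compactness and convexity. -/
lemma setOf_sqDiag_mem_eq_image (hS : IsPowerConstraint S) :
    {l | sqDiag l ∈ S} = (fun (Q : Matrix (Fin t) (Fin t) ℂ) i => (Q i i).re) '' S := by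
  ext l
  constructor
  · intro h
    exact ⟨sqDiag l, h, by funext i; simp [sqDiag]⟩
  · rintro ⟨Q, hQ, rfl⟩
    exact hS.sqDiag_re_diag_mem hQ

lemma isCompact_setOf_sqDiag_mem (hS : IsPowerConstraint S) : IsCompact {l | sqDiag l ∈ S} := by
  rw [hS.setOf_sqDiag_mem_eq_image]
  exact hS.compact.image (continuous_pi fun i =>
    Complex.continuous_re.comp (continuous_id.matrix_elem i i))

lemma nonempty_setOf_sqDiag_mem (hS : IsPowerConstraint S) : {l | sqDiag l ∈ S}.Nonempty := by
  rw [hS.setOf_sqDiag_mem_eq_image]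
  exact hS.nonempty.image _

lemma nonneg_of_sqDiag_mem (hS : IsPowerConstraint S) {l : Fin t → ℝ} (hl : sqDiag l ∈ S) :
    0 ≤ l := posSemidef_sqDiag_iff.1 (hS.posSemidef _ hl)

/-- A Hermitian matrix lies in the constraint set as soon as the diagonal matrix of its ordered
eigenvalues does. -/
lemma sqDiag_eigVals_mem_iff (hS : IsPowerConstraint S) {Q : Matrix (Fin t) (Fin t) ℂ}
    (hQ : Q.IsHermitian) : sqDiag (eigVals hQ) ∈ S ↔ Q ∈ S := by
  obtain ⟨V, hV, p, h⟩ := exists_unitary_eq_eigVals hQ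
  rw [← hS.sqDiag_perm_mem_iff _ p, ← hS.conj_mem_iff hV, ← h]

lemma isEigenvalueRegion (hS : IsPowerConstraint S) :
    IsEigenvalueRegion S {l | sqDiag l ∈ S} where
  nonempty := hS.nonempty_setOf_sqDiag_mem
  compact := hS.isCompact_setOf_sqDiag_mem
  convex := by
    rw [hS.setOf_sqDiag_mem_eq_image]
    exact hS.convex.is_linear_image
      ⟨fun _ _ => by funext i; simp, fun _ _ => by funext i; simp⟩
  perm := fun x hx p => (hS.sqDiag_perm_mem_iff x p).2 hx
  eq := by
    ext Q
    constructor
    · intro hQ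
      have hP := hS.posSemidef Q hQ
      have h := (hS.sqDiag_eigVals_mem_iff hP.isHermitian).2 hQ
      exact ⟨hP, h, hS.nonneg_of_sqDiag_mem h⟩
    · rintro ⟨hP, h, -⟩
      exact (hS.sqDiag_eigVals_mem_iff hP.isHermitian).1 h

end IsPowerConstraint

/-- The nonnegative part of an eigenvalue region is determined by the constraint set. -/
lemma IsEigenvalueRegion.powerRegion_eq {B : Set (Fin t → ℝ)} (hB : IsEigenvalueRegion S B) :
    powerRegion B = {l | sqDiag l ∈ S} := by
  have key : ∀ l : Fin t → ℝ, ∃ p : Equiv.Perm (Fin t),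
      eigVals (sqDiag_isHermitian l) = fun i => l (p i) :=
    fun l => exists_perm_eigVals (sqDiag_isHermitian l) (one_mem _) (by simp)
  ext l
  obtain ⟨p, hp⟩ := key l
  constructor
  · rintro ⟨hl, hl0⟩
    change sqDiag l ∈ S
    rw [hB.eq]
    exact ⟨posSemidef_sqDiag_iff.2 hl0, hp ▸ hB.perm l hl p, hp ▸ fun i => hl0 (p i)⟩
  · intro h
    change sqDiag l ∈ S at h
    rw [hB.eq] at h
    obtain ⟨hP, h1, -⟩ := h
    rw [hp] at h1
    refine ⟨?_, posSemidef_sqDiag_iff.1 hP⟩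
    simpa using hB.perm _ h1 p⁻¹

end

/-! ### The two min-max problems -/

section

/-- A continuous min-max problem over nonempty compact sets has a solution. -/
lemma exists_isMinMaxSolution {α β : Type*} [TopologicalSpace α] [TopologicalSpace β]
    {f F : α → β → ℝ} {X : Set α} {Y : Set β} (hX : IsCompact X) (hX0 : X.Nonempty)
    (hY : IsCompact Y) (hY0 : Y.Nonempty) (hF : Continuous (Function.uncurry F))
    (hfF : ∀ x, ∀ y ∈ Y, f x y = F x y) : ∃ x y, IsMinMaxSolution f X Y x y := by
  have himg : ∀ x, f x '' Y = F x '' Y := fun x => Set.image_congr (hfF x)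
  have hg : ∀ x, IsGreatest (f x '' Y) (sSup (F x '' Y)) := fun x => by
    rw [himg]
    exact (hY.image (hF.comp (Continuous.prodMk_right x))).isGreatest_sSup (hY0.image _)
  obtain ⟨x, hx, hmin⟩ := hX.exists_isMinOn hX0 (hY.continuous_sSup hF).continuousOn
  obtain ⟨y, hy, hxy⟩ := (hg x).1
  refine ⟨x, y, hx, hy, hxy ▸ hg x, fun z _ => ⟨_, hg z⟩, ⟨x, hx, hxy ▸ hg x⟩, ?_⟩
  rintro M ⟨z, hz, hM⟩
  rw [hM.unique (hg z), hxy]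
  exact hmin hz

variable {r t : ℕ} {N : Seminorm ℂ (Matrix (Fin r) (Fin t) ℂ)}

lemma IsSymmetricGauge.isCompact_scalarBall {k : ℕ} {g : Seminorm ℝ (Fin k → ℝ)}
    (hg : IsSymmetricGauge g) (x₀ : Fin k → ℝ) (ε : ℝ) : IsCompact (scalarBall g x₀ ε) := by
  have hcont := g.continuous_pi_fin
  obtain ⟨m, hm, hle⟩ : ∃ m, 0 < m ∧ ∀ x, m * ‖x‖ ≤ g x := by
    rcases (Metric.sphere (0 : Fin k → ℝ) 1).eq_empty_or_nonempty with h0 | h0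
    · refine ⟨1, one_pos, fun x => ?_⟩
      rcases eq_or_ne x 0 with rfl | hx
      · simp
      · have : ‖x‖⁻¹ • x ∈ Metric.sphere (0 : Fin k → ℝ) 1 := by
          simp [norm_smul, inv_mul_cancel₀ (norm_ne_zero_iff.2 hx)]
        rw [h0] at this
        exact this.elim
    · obtain ⟨y, hy, hmin⟩ := (isCompact_sphere (0 : Fin k → ℝ) 1).exists_isMinOn h0
        hcont.continuousOn
      have hy1 : ‖y‖ = 1 := by simpa using hy
      refine ⟨g y, (apply_nonneg g y).lt_of_ne fun h => ?_, fun x => ?_⟩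
      · rw [hg.definite y h.symm] at hy1
        simp at hy1
      · rcases eq_or_ne x 0 with rfl | hx
        · simp
        · have hx' := norm_pos_iff.2 hx
          have h1 : g y ≤ g (‖x‖⁻¹ • x) := hmin (by
            simp [norm_smul, inv_mul_cancel₀ (norm_ne_zero_iff.2 hx)])
          rw [map_smul_eq_mul, norm_inv, norm_norm, inv_mul_eq_div, le_div_iff₀ hx'] at h1
          exact h1
  refine (isCompact_closedBall x₀ (ε / m)).of_isClosed_subset ?_ fun x hx => ?_
  · exact (isClosed_le (hcont.comp (continuous_id.sub continuous_const)) continuous_const).inter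
      (isClosed_le continuous_const continuous_id)
  · rw [mem_closedBall_iff_norm, le_div_iff₀ hm, mul_comm]
    exact (hle _).trans hx.1

lemma exists_scalar_solution {γ : ℝ} (hγ : 0 ≤ γ) {X : Set (Fin (min r t) → ℝ)}
    (hX : IsCompact X) (hX0 : X.Nonempty) {Y : Set (Fin t → ℝ)} (hY : IsCompact Y)
    (hY0 : Y.Nonempty) (hYnn : ∀ l ∈ Y, 0 ≤ l) :
    ∃ σ l, IsMinMaxSolution (scalarInfo (r := r) γ) X Y σ l := by
  -- truncating `l` at `0` makes the logarithms continuous everywhere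
  refine exists_isMinMaxSolution (F := fun σ l => scalarInfo γ σ fun i => max (l i) 0)
    hX hX0 hY hY0 ?_ fun σ l hl => ?_
  · simp only [Function.uncurry_def, scalarInfo]
    refine continuous_finsetSum _ fun i _ => Continuous.log (by fun_prop) fun q => ?_
    positivity
  · congr 1
    funext i
    exact (max_eq_left (hYnn l hl i)).symm

/-- For a channel with given singular frames, the best transmit covariance may be taken diagonal in
the right singular frame, so that the inner maximum is that of the scalar problem. -/
lemma isGreatest_mutualInfo_iff {γ : ℝ} (hγ : 0 ≤ γ) {S : Set (Matrix (Fin t) (Fin t) ℂ)}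
    (hS : IsPowerConstraint S) {U : Matrix (Fin r) (Fin r) ℂ}
    (hU : U ∈ Matrix.unitaryGroup (Fin r) ℂ) {V : Matrix (Fin t) (Fin t) ℂ}
    (hV : V ∈ Matrix.unitaryGroup (Fin t) ℂ) (σ : Fin (min r t) → ℝ) (M : ℝ) :
    IsGreatest (mutualInfo γ (U * rectDiag r t σ * Vᴴ) '' S) M
      ↔ IsGreatest (scalarInfo γ σ '' {l | sqDiag l ∈ S}) M := by
  have h1 : scalarInfo γ σ '' {l | sqDiag l ∈ S}
      ⊆ mutualInfo γ (U * rectDiag r t σ * Vᴴ) '' S := by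
    rintro _ ⟨l, hl, rfl⟩
    refine ⟨V * sqDiag l * Vᴴ, hS.conj_mem _ hl V hV, ?_⟩
    rw [mutualInfo_conj γ hU, conjTranspose_mul_mul_of_eq hV hV rfl,
      mutualInfo_rectDiag_sqDiag hγ σ (hS.nonneg_of_sqDiag_mem hl)]
  have h2 : ∀ Q ∈ S, ∃ l, sqDiag l ∈ S ∧
      mutualInfo γ (U * rectDiag r t σ * Vᴴ) Q ≤ scalarInfo γ σ l := by
    intro Q hQ
    have hQ' : Vᴴ * Q * V ∈ S := by
      simpa using hS.conj_mem Q hQ Vᴴ (Unitary.star_mem hV)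
    refine ⟨_, hS.sqDiag_re_diag_mem hQ', ?_⟩
    rw [mutualInfo_conj γ hU]
    exact mutualInfo_rectDiag_le hγ σ (hS.posSemidef _ hQ')
  constructor
  · rintro ⟨⟨Q, hQ, rfl⟩, hub⟩
    obtain ⟨l, hl, hle⟩ := h2 Q hQ
    have hmem := Set.mem_image_of_mem (scalarInfo γ σ) (show l ∈ {l | sqDiag l ∈ S} from hl)
    have heq := le_antisymm hle (hub (h1 hmem))
    exact ⟨heq ▸ hmem, fun y hy => hub (h1 hy)⟩
  · rintro ⟨hM, hub⟩
    refine ⟨h1 hM, ?_⟩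
    rintro _ ⟨Q, hQ, rfl⟩
    obtain ⟨l, hl, hle⟩ := h2 Q hQ
    exact hle.trans (hub ⟨l, hl, rfl⟩)

end

theorem theorem2 (r t : ℕ) (γ ε : ℝ) (hγ : 0 ≤ γ)
    (N : Seminorm ℂ (Matrix (Fin r) (Fin t) ℂ)) (hN : IsUnitarilyInvariantNorm N)
    (S : Set (Matrix (Fin t) (Fin t) ℂ)) (hS : IsPowerConstraint S)
    (H₀ : Matrix (Fin r) (Fin t) ℂ) (hne : (channelBall N H₀ ε).Nonempty)
    (U₀ : Matrix (Fin r) (Fin r) ℂ) (hU₀ : U₀ ∈ Matrix.unitaryGroup (Fin r) ℂ)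
    (V₀ : Matrix (Fin t) (Fin t) ℂ) (hV₀ : V₀ ∈ Matrix.unitaryGroup (Fin t) ℂ)
    (hSVD : H₀ = U₀ * rectDiag r t (singVals H₀) * V₀ᴴ) :
    (∃ g, IsAssociatedGauge N g) ∧
    (∃ B, IsEigenvalueRegion S B) ∧
    ∀ g B, IsAssociatedGauge N g → IsEigenvalueRegion S B →
      -- the scalar problem has a solution
      (∃ σ' l', IsMinMaxSolution (scalarInfo (r := r) γ)
        (scalarBall g (singVals H₀) ε) (powerRegion B) σ' l') ∧
      -- the matrix problem and the scalar problem have the same optimal value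
      (∃ C, IsMinMaxValue (mutualInfo γ) (channelBall N H₀ ε) S C ∧
        IsMinMaxValue (scalarInfo (r := r) γ)
          (scalarBall g (singVals H₀) ε) (powerRegion B) C) ∧
      -- every solution of the scalar problem yields a solution of the matrix problem
      (∀ σ' l', IsMinMaxSolution (scalarInfo (r := r) γ)
          (scalarBall g (singVals H₀) ε) (powerRegion B) σ' l' →
        IsMinMaxSolution (mutualInfo γ) (channelBall N H₀ ε) S
          (U₀ * rectDiag r t σ' * V₀ᴴ) (V₀ * sqDiag l' * V₀ᴴ)) := by
  refine ⟨⟨_, hN.isAssociatedGauge⟩, ⟨_, hS.isEigenvalueRegion⟩, fun g B hg hB => ?_⟩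
  obtain rfl : g = diagSeminorm N := Seminorm.ext fun x => hg.apply_eq x
  rw [hB.powerRegion_eq]
  set X := scalarBall (diagSeminorm N) (singVals H₀) ε
  have hε : 0 ≤ ε := by
    obtain ⟨H, hH⟩ := hne
    exact (apply_nonneg N _).trans hH
  have hX0 : X.Nonempty := ⟨singVals H₀, by simpa using hε, singVals_nonneg H₀⟩
  -- channels sharing the singular frames of `H₀` are feasible when their diagonals are
  have hmemH : ∀ σ ∈ X, U₀ * rectDiag r t σ * V₀ᴴ ∈ channelBall N H₀ ε := by
    intro σ hσ
    have hsub : U₀ * rectDiag r t σ * V₀ᴴ - H₀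
        = U₀ * rectDiag r t (σ - singVals H₀) * V₀ᴴ := by
      have : rectDiag r t σ = rectDiag r t (σ - singVals H₀) + rectDiag r t (singVals H₀) := by
        rw [← rectDiag_add, sub_add_cancel]
      conv_lhs => rw [this, Matrix.mul_add, Matrix.add_mul, ← hSVD, add_sub_cancel_right]
    change N _ ≤ ε
    rw [hsub, hN.conj_eq _ hU₀ hV₀]
    exact hσ.1
  have hmemσ : ∀ H ∈ channelBall N H₀ ε, singVals H ∈ X := fun H hH =>
    ⟨(hN.singVals_sub_le H₀ H).trans hH, singVals_nonneg H⟩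
  have hvalue : ∀ C, IsMinMaxValue (scalarInfo (r := r) γ) X {l | sqDiag l ∈ S} C →
      IsMinMaxValue (mutualInfo γ) (channelBall N H₀ ε) S C := by
    intro C hC
    refine ⟨fun H hH => ?_, ?_, ?_⟩
    · obtain ⟨U, hU, V, hV, h⟩ := exists_svd H
      obtain ⟨M, hM⟩ := hC.max_attained _ (hmemσ H hH)
      rw [← isGreatest_mutualInfo_iff hγ hS hU hV, ← h] at hM
      exact ⟨M, hM⟩
    · obtain ⟨σ, hσ, hM⟩ := hC.isLeast.1
      exact ⟨_, hmemH σ hσ, (isGreatest_mutualInfo_iff hγ hS hU₀ hV₀ σ C).2 hM⟩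
    · rintro M ⟨H, hH, hM⟩
      obtain ⟨U, hU, V, hV, h⟩ := exists_svd H
      rw [h, isGreatest_mutualInfo_iff hγ hS hU hV] at hM
      exact hC.isLeast.2 ⟨_, hmemσ H hH, hM⟩
  have hsol := exists_scalar_solution hγ (hg.gauge.isCompact_scalarBall (singVals H₀) ε) hX0
    hS.isCompact_setOf_sqDiag_mem hS.nonempty_setOf_sqDiag_mem fun l hl => hS.nonneg_of_sqDiag_mem hl
  refine ⟨hsol, ?_, fun σ' l' h => ?_⟩
  · obtain ⟨σ, l, h⟩ := hsol
    exact ⟨_, hvalue _ h.isMinMaxValue, h.isMinMaxValue⟩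
  · have hval : mutualInfo γ (U₀ * rectDiag r t σ' * V₀ᴴ) (V₀ * sqDiag l' * V₀ᴴ)
        = scalarInfo γ σ' l' := by
      rw [mutualInfo_conj γ hU₀, conjTranspose_mul_mul_of_eq hV₀ hV₀ rfl,
        mutualInfo_rectDiag_sqDiag hγ σ' (hS.nonneg_of_sqDiag_mem h.mem_right)]
    refine ⟨hmemH σ' h.mem_left, hS.conj_mem _ h.mem_right V₀ hV₀, ?_, ?_⟩
    · rw [hval, isGreatest_mutualInfo_iff hγ hS hU₀ hV₀]
      exact h.isGreatest
    · rw [hval]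
      exact hvalue _ h.isMinMaxValue
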